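/- Let $\mathrm{Nil}_n$ ($n\ge 0$) be the full subcategory of the category of groups on the free nilpotent groups $F_k/\Gamma_{n+1}F_k$, $k\ge 1$, of class $n$ (one object for each $k$), where $\Gamma_1F_k=F_k$ and $\Gamma_{i+1}F_k=[\Gamma_iF_k,F_k]$. Let $\mathrm{Ho}(\mathrm{Spaces}_*)$ be the category of pointed spaces localized at the weak homotopy equivalences. Let $X$ be a pointed space. The loop space $\Omega X$ is called nilpotent up to homotopy of class $\le n$ if there are a functor $N\colon \mathrm{Nil}_n^{\mathrm{op}}\to\mathrm{Ho}(\mathrm{Spaces}_*)$ that preserves nonempty finite products, and an isomorphism $N(1)\cong\Omega X$ in $\mathrm{Ho}(\mathrm{Spaces}_*)$ under which the multiplication $N(1)\times N(1)\cong N(2)\to N(1)$ given by the element $x_1x_2\in F_2/\Gamma_{n+1}F_2$ corresponds to the concatenation of loops $\Omega X\times\Omega X\to\Omega X$. For $a,b\ge 0$, $\alpha\in\pi_{a+1}X$ and $\beta\in\pi_{b+1}X$ with adjoints $\alpha'\colon S^a\to\Omega X$ and $\beta'\colon S^b\to\Omega X$, the composite of $\alpha'\times\beta'$ with the commutator map $\Omega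 X\times\Omega X\to\Omega X$ factors through the quotient map $S^a\times S^b\to S^{a+b}$, uniquely up to homotopy. The factorization represents the Samelson product $\langle\alpha',\beta'\rangle\in\pi_{a+b}(\Omega X)$, and its adjoint class is the Whitehead product $[\alpha,\beta]\in\pi_{a+b+1}X$. A $1$-fold iterated Whitehead product is any class in $\pi_{m+1}X$ with $m\ge 0$, and a $(j+k)$-fold one is a Whitehead product of a $j$-fold and a $k$-fold one ($j,k\ge1$), so every bracketing is allowed. **Proposition.** If $\Omega X$ is nilpotent up to homotopy of class $\le n$, then all $(n+1)$-fold iterated Whitehead products vanish in $X$. -/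

import Mathlib

open CategoryTheory CategoryTheory.Limits Opposite
open scoped unitInterval Topology Topology.Homotopy

universe u

namespace NilHtpy

noncomputable section

/-! ### Pointed spaces and their homotopy category -/

/-- A pointed topological space. -/
structure PtdSpace : Type (u + 1) where
  /-- the underlying space -/
  carrier : Type u
  [top : TopologicalSpace carrier]
  /-- the base point -/
  pt : carrier

attribute [instance] PtdSpace.top

namespace PtdSpace

/-- A continuous map preserving the base points. -/
@[ext]
structure Hom (X Y : PtdSpace.{u}) : Type u where
  /-- the underlying continuous map -/
  map : C(X.carrier, Y.carrier)
  map_pt : map X.pt = Y.pt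

instance : Category PtdSpace.{u} where
  Hom X Y := Hom X Y
  id X := ⟨ContinuousMap.id _, rfl⟩
  comp f g := ⟨g.map.comp f.map, by simp [f.map_pt, g.map_pt]⟩

/-- The product of two pointed spaces. -/
def prod (X Y : PtdSpace.{u}) : PtdSpace.{u} := ⟨X.carrier × Y.carrier, (X.pt, Y.pt)⟩

/-- The first projection. -/
def fst (X Y : PtdSpace.{u}) : X.prod Y ⟶ X := Hom.mk ⟨Prod.fst, continuous_fst⟩ rfl

/-- The second projection. -/
def snd (X Y : PtdSpace.{u}) : X.prod Y ⟶ Y := Hom.mk ⟨Prod.snd, continuous_snd⟩ rfl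

/-- The loop space of `X`: the space of loops at the base point with the compact-open topology,
based at the constant loop. -/
def loop (X : PtdSpace.{u}) : PtdSpace.{u} := ⟨LoopSpace X.carrier X.pt, Path.refl X.pt⟩

/-- Concatenation of loops, as a pointed map `ΩX × ΩX ⟶ ΩX`. -/
def concat (X : PtdSpace.{u}) : X.loop.prod X.loop ⟶ X.loop :=
  Hom.mk ⟨fun p : Path X.pt X.pt × Path X.pt X.pt => p.1.trans p.2, Path.continuous_trans⟩
    Path.refl_trans_refl

end PtdSpace

/-- The map `π_n(X, x) → π_n(Y, f x)` induced by a continuous map `f`. -/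
def homotopyGroupMap {X Y : Type u} [TopologicalSpace X] [TopologicalSpace Y] (n : ℕ)
    (f : C(X, Y)) (x : X) : π_ n X x → π_ n Y (f x) :=
  Quotient.map (fun p : Ω^ (Fin n) X x => (⟨f.comp p.1, fun y hy => by
      simpa using congrArg f (p.2 y hy)⟩ : Ω^ (Fin n) Y (f x)))
    fun _ _ h => ContinuousMap.HomotopicRel.comp_continuousMap h f

/-- The weak homotopy equivalences: the pointed maps that induce bijections on `π_n` for all
`n ≥ 0` and all choices of a base point in the source. -/
def weakEquivalences : MorphismProperty PtdSpace.{u} :=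
  fun X _ f => ∀ (n : ℕ) (x : X.carrier), Function.Bijective (homotopyGroupMap n f.map x)

/-- The homotopy category of pointed spaces: pointed spaces with the weak homotopy equivalences
formally inverted. -/
abbrev HoSpaces := (weakEquivalences.{u}).Localization

/-- The localization functor from pointed spaces to their homotopy category. -/
abbrev toHo : PtdSpace.{u} ⥤ HoSpaces.{u} := (weakEquivalences.{u}).Q

/-! ### The theory of nilpotent groups -/

/-- The free nilpotent group `F_k / Γ_{n+1} F_k` of class `n` on `k` generators.  (Mathlib indexes
the lower central series from `0`, so that `Γ_{n+1}` is `lowerCentralSeries ⊤ n`.) -/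
abbrev FreeNil (n k : ℕ) : Type :=
  FreeGroup (Fin k) ⧸ (⊤ : Subgroup (FreeGroup (Fin k))).lowerCentralSeries n

/-- The algebraic theory `Nil_n`: its objects are indexed by the integers `k ≥ 1`, and the
morphisms are the group homomorphisms between the groups `F_k / Γ_{n+1} F_k`. -/
structure NilTheory (n : ℕ) : Type where
  /-- the number `k` of generators -/
  rank : ℕ
  pos : 1 ≤ rank

instance (n : ℕ) : Category (NilTheory n) where
  Hom S T := FreeNil n S.rank →* FreeNil n T.rank
  id S := MonoidHom.id _
  comp f g := g.comp f

/-- The object `F_{k+1} / Γ_{n+1} F_{k+1}` of `Nil_n`. -/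
def NilTheory.obj (n k : ℕ) : NilTheory n := ⟨k + 1, Nat.le_add_left 1 k⟩

/-- The morphism from `F_1 / Γ_{n+1} F_1` to `F_{k+1} / Γ_{n+1} F_{k+1}` in `Nil_n` that sends the
generator to the class of the word `w`. -/
def NilTheory.ofWord (n k : ℕ) (w : FreeGroup (Fin (k + 1))) :
    NilTheory.obj n 0 ⟶ NilTheory.obj n k :=
  QuotientGroup.map ((⊤ : Subgroup (FreeGroup (Fin 1))).lowerCentralSeries n)
    ((⊤ : Subgroup (FreeGroup (Fin (k + 1)))).lowerCentralSeries n)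
    (FreeGroup.lift fun _ : Fin 1 => w) (by
      rw [← Subgroup.map_le_iff_le_comap, Subgroup.map_lowerCentralSeries]
      exact Subgroup.lowerCentralSeries_mono n le_top)

/-- A nilpotent group up to homotopy of class `≤ n`: a product-preserving contravariant functor
from `Nil_n` to the homotopy category of pointed spaces. -/
structure NilGroupUpToHomotopy (n : ℕ) where
  /-- the underlying functor -/
  functor : (NilTheory n)ᵒᵖ ⥤ HoSpaces.{u}
  /-- the functor preserves all nonempty finite products -/
  preserves : ∀ k : ℕ, PreservesLimitsOfShape (Discrete (Fin (k + 1))) functor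

/-- The loop space `ΩX` is nilpotent up to homotopy of class `≤ n`: there is a nilpotent group up
to homotopy `N` of class `≤ n` and an isomorphism `N(1) ≅ ΩX` in the homotopy category under which
the multiplication of `N`, which comes from the word `x₁x₂`, is the concatenation of loops.  Here
`e` is the isomorphism `ΩX × ΩX ≅ N(1) × N(1) ≅ N(2)`, which is determined by its two components,
as `N` preserves products. -/
def LoopSpaceIsNilpotentUpToHomotopy (X : PtdSpace.{u}) (n : ℕ) : Prop :=
  ∃ (N : NilGroupUpToHomotopy.{u} n)
    (φ : N.functor.obj (op (NilTheory.obj n 0)) ≅ toHo.obj X.loop)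
    (e : toHo.obj (X.loop.prod X.loop) ⟶ N.functor.obj (op (NilTheory.obj n 1))),
    e ≫ N.functor.map (NilTheory.ofWord n 1 (FreeGroup.of 0)).op ≫ φ.hom =
      toHo.map (PtdSpace.fst X.loop X.loop) ∧
    e ≫ N.functor.map (NilTheory.ofWord n 1 (FreeGroup.of 1)).op ≫ φ.hom =
      toHo.map (PtdSpace.snd X.loop X.loop) ∧
    e ≫ N.functor.map (NilTheory.ofWord n 1 (FreeGroup.of 0 * FreeGroup.of 1)).op ≫ φ.hom =
      toHo.map (PtdSpace.concat X)

/-! ### Samelson and Whitehead products -/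

section Products

variable {X : Type u} [TopologicalSpace X] {x : X}

/-- The adjoint `S^a → ΩX` of a map `S^{a+1} → X`; the last coordinate of the cube becomes the
loop parameter. -/
def adjoint {a : ℕ} (f : Ω^ (Fin (a + 1)) X x) : Ω^ (Fin a) (LoopSpace X x) (Path.refl x) :=
  ⟨⟨fun s =>
      { toFun := fun u => f (Fin.snoc (α := fun _ => I) s u)
        continuous_toFun := f.1.continuous.comp (by fun_prop)
        source' := f.2 _ ⟨Fin.last a, Or.inl (by simp)⟩
        target' := f.2 _ ⟨Fin.last a, Or.inr (by simp)⟩ },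
      Path.continuous_uncurry_iff.1 (f.1.continuous.comp (by fun_prop))⟩,
    fun s hs => by
      obtain ⟨i, hi⟩ := hs
      ext u
      exact f.2 _ ⟨i.castSucc, by simpa using hi⟩⟩

/-- The commutator `p q p⁻¹ q⁻¹` of two loops. -/
def loopCommutator (p q : LoopSpace X x) : LoopSpace X x :=
  ((p.trans q).trans p.symm).trans q.symm

theorem continuous_loopCommutator {Z : Type*} [TopologicalSpace Z] {p q : Z → LoopSpace X x}
    (hp : Continuous p) (hq : Continuous q) : Continuous fun z => loopCommutator (p z) (q z) :=
  ((hp.path_trans hq).path_trans (Path.continuous_symm.comp hp)).path_trans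
    (Path.continuous_symm.comp hq)

/-- The composite of `f × g : S^a × S^b → ΩX × ΩX` with the commutator map `ΩX × ΩX → ΩX`. -/
def commutatorMap {a b : ℕ} (f : Ω^ (Fin a) (LoopSpace X x) (Path.refl x))
    (g : Ω^ (Fin b) (LoopSpace X x) (Path.refl x)) :
    C((I^ (Fin a)) × (I^ (Fin b)), LoopSpace X x) :=
  ⟨fun z => loopCommutator (f z.1) (g z.2),
    continuous_loopCommutator (f.1.continuous.comp continuous_fst)
      (g.1.continuous.comp continuous_snd)⟩

/-- The composite of the quotient map `S^a × S^b → S^{a+b}`, which collapses the wedge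
`S^a ∨ S^b`, with a map `h` from `S^{a+b}`. -/
def pullbackToProd {Y : Type u} [TopologicalSpace Y] {y : Y} {a b : ℕ}
    (h : Ω^ (Fin (a + b)) Y y) : C((I^ (Fin a)) × (I^ (Fin b)), Y) :=
  ⟨fun z => h (Fin.append z.1 z.2), h.1.continuous.comp (by fun_prop)⟩

/-- The map `φ` on `I^a × I^b` is a pointed map from `S^a × S^b` to `(Y, y)`, where the sphere `S^a`
is the quotient of the cube `I^a` by its boundary, the base point being the image of the boundary.
(For `a = 0` the boundary is empty, and the cube is the component of `S^0` that does not contain the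
base point.) -/
def IsPointedMapOfProdSpheres {Y : Type u} [TopologicalSpace Y] (y : Y) {a b : ℕ}
    (φ : C((I^ (Fin a)) × (I^ (Fin b)), Y)) : Prop :=
  (∀ s ∈ Cube.boundary (Fin a), ∀ s' ∈ Cube.boundary (Fin a), ∀ t, φ (s, t) = φ (s', t)) ∧
  (∀ t ∈ Cube.boundary (Fin b), ∀ t' ∈ Cube.boundary (Fin b), ∀ s, φ (s, t) = φ (s, t')) ∧
  (∀ s ∈ Cube.boundary (Fin a), ∀ t ∈ Cube.boundary (Fin b), φ (s, t) = y)

/-- `h : S^{a+b} → ΩX` represents the Samelson product of `f : S^a → ΩX` and `g : S^b → ΩX`: it is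
the factorization through `S^{a+b}`, which exists and is unique up to homotopy, of the commutator
map `S^a × S^b → ΩX` of `f` and `g`; that is, `S^a × S^b → S^{a+b} → ΩX` is homotopic to the
commutator map through pointed maps. -/
def IsSamelsonProduct {a b : ℕ} (f : Ω^ (Fin a) (LoopSpace X x) (Path.refl x))
    (g : Ω^ (Fin b) (LoopSpace X x) (Path.refl x))
    (h : Ω^ (Fin (a + b)) (LoopSpace X x) (Path.refl x)) : Prop :=
  ContinuousMap.HomotopicWith (pullbackToProd h) (commutatorMap f g)
    (IsPointedMapOfProdSpheres (Path.refl x))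

/-- `γ ∈ π_{a+b+1}(X)` is the Whitehead product `[α, β]` of `α ∈ π_{a+1}(X)` and
`β ∈ π_{b+1}(X)`: its adjoint class is the Samelson product of the adjoint classes. -/
def IsWhiteheadProduct {a b : ℕ} (α : π_ (a + 1) X x) (β : π_ (b + 1) X x)
    (γ : π_ (a + b + 1) X x) : Prop :=
  ∃ (f : Ω^ (Fin (a + 1)) X x) (g : Ω^ (Fin (b + 1)) X x) (h : Ω^ (Fin (a + b + 1)) X x),
    (⟦f⟧ : π_ (a + 1) X x) = α ∧ (⟦g⟧ : π_ (b + 1) X x) = β ∧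
    (⟦h⟧ : π_ (a + b + 1) X x) = γ ∧
    IsSamelsonProduct (adjoint f) (adjoint g) (adjoint h)

/-- `IsIteratedWhiteheadProduct k m γ`: the class `γ ∈ π_{m+1}(X)` is a `k`-fold iterated Whitehead
product, with an arbitrary bracketing, of `k` classes in the homotopy groups of `X`. -/
inductive IsIteratedWhiteheadProduct : (k m : ℕ) → π_ (m + 1) X x → Prop
  | single {a : ℕ} (α : π_ (a + 1) X x) : IsIteratedWhiteheadProduct 1 a α
  | bracket {j k a b : ℕ} {α : π_ (a + 1) X x} {β : π_ (b + 1) X x} {γ : π_ (a + b + 1) X x}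
      (hα : IsIteratedWhiteheadProduct j a α) (hβ : IsIteratedWhiteheadProduct k b β)
      (hγ : IsWhiteheadProduct α β γ) : IsIteratedWhiteheadProduct (j + k) (a + b) γ

end Products

end

end NilHtpy

/-! Write `[T^m, Y]` for the set of free homotopy classes of maps from the `m`-torus to `Y`,
realized as maps on the cube `I^m` that agree on opposite faces. Concatenation of loops makes `[T^m,
ΩX]` a group. The proof shows that this group is nilpotent of class at most `n`, and that iterated
Whitehead products are detected in it as iterated commutators.

Nilpotency: `[T^m, -]` sends weak equivalences to bijections
(`IsWeakEquiv.bijective_torusClassMap`), so it extends to the homotopy category and can be applied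
to `N`. Given classes `t_1, ..., t_k` in `[T^m, ΩX]`, product preservation yields one `ξ` in `[T^m,
N(k)]` with these components. Letting words act on `ξ` defines a homomorphism from the free group
`F_k` to `[T^m, ΩX]` that sends generators to the `t_i`. A word in `Γ_{n+1}F_k` induces the same
morphism of `Nil_n` as the empty word, hence acts trivially (`eq_one_of_isIteratedCommutator`).

Whitehead products: a class in `π_{m+1}X` gives an element of `[T^m, ΩX]` by taking the adjoint and
composing with `T^m → S^m`. Since `T^{a+b} → S^{a+b}` factors through `S^a × S^b`, a Samelson
product becomes the commutator of two classes pulled back along the coordinate projections of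
`T^{a+b}` (`IsSamelsonProduct.mk_eq_commutator`). So an `(n+1)`-fold Whitehead product becomes an
`(n+1)`-fold commutator, which is trivial.

Finally, a class of `π_{m+1}X` that becomes trivial on the torus is trivial
(`eq_one_of_adjointClass_eq_one`). The suspension of `T^m → S^m` splits up to homotopy; concretely,
a null homotopy on the torus is made trivial on opposite faces, one coordinate at a time, by
multiplying with the inverse of its restriction to a face.

That weak equivalences act bijectively on `[T^m, -]` is proved from homotopy groups: first homotopy
extension and lifting for cubes (`IsWeakEquiv.hasHELP`), then its passage to free loop spaces
(`HasHELP.freeLoop`), then induction on `m`, as a map from `T^{m+1}` is a map from `T^m` to the free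
loop space. -/

namespace NilHtpy

/-! ### The homotopy extension property -/

/-- The set `S` is a deformation-type retract in the sense that `{0} × A ∪ I × S` is a retract of
`I × A`; for closed `S` this is the homotopy extension property of the pair `(A, S)`. -/
def HasHEP {A : Type*} [TopologicalSpace A] (S : Set A) : Prop :=
  ∃ r : C(I × A, I × A), (∀ p, (r p).1 = 0 ∨ (r p).2 ∈ S) ∧ (∀ a, r (0, a) = (0, a)) ∧
    ∀ t, ∀ a ∈ S, r (t, a) = (t, a)

/-- The map `b` on `{0} × A` and `H` on `I × S` glue to a continuous map on a union of two closed
sets, which is then precomposed with the retraction. Values of `H` off `I × S` play no role, so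
partial homotopies can be passed as total functions. -/
theorem HasHEP.extend {A Z : Type*} [TopologicalSpace A] [TopologicalSpace Z] {S : Set A}
    (h : HasHEP S) (hS : IsClosed S) (b : C(A, Z)) (H : I × A → Z)
    (hH : ContinuousOn H (Set.univ ×ˢ S)) (h0 : ∀ a ∈ S, H (0, a) = b a) :
    ∃ K : C(I × A, Z), (∀ a, K (0, a) = b a) ∧ ∀ t, ∀ a ∈ S, K (t, a) = H (t, a) := by
  classical
  obtain ⟨r, hr, hr0, hrS⟩ := h
  let g : I × A → Z := fun p => if p.1 = 0 then b p.2 else H p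
  have hg : ContinuousOn g (({0} : Set I) ×ˢ Set.univ ∪ Set.univ ×ˢ S) := by
    refine ContinuousOn.union_of_isClosed ?_ ?_ (isClosed_singleton.prod isClosed_univ)
      (isClosed_univ.prod hS)
    · refine (b.continuous.comp continuous_snd).continuousOn.congr ?_
      rintro ⟨t, a⟩ ⟨ht, -⟩
      simp only [Set.mem_singleton_iff] at ht
      simp [g, ht]
    · refine hH.congr ?_
      rintro ⟨t, a⟩ ⟨-, ha⟩
      by_cases ht : t = 0
      · subst ht; simp [g, h0 a ha]
      · simp [g, ht]
  refine ⟨⟨fun p => g (r p), hg.comp_continuous r.continuous fun p => ?_⟩, fun a => ?_,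
    fun t a ha => ?_⟩
  · rcases hr p with h | h
    · exact Or.inl ⟨h, trivial⟩
    · exact Or.inr ⟨trivial, h⟩
  · simp [g, hr0]
  · by_cases ht : t = 0
    · subst ht; simp [g, hr0, h0 a ha]
    · simp [g, hrS t a ha, ht]

theorem HasHEP.extend_one {A Z : Type*} [TopologicalSpace A] [TopologicalSpace Z] {S : Set A}
    (h : HasHEP S) (hS : IsClosed S) (b : C(A, Z)) (H : I × A → Z)
    (hH : ContinuousOn H (Set.univ ×ˢ S)) (h1 : ∀ a ∈ S, H (1, a) = b a) :
    ∃ K : C(I × A, Z), (∀ a, K (1, a) = b a) ∧ ∀ t, ∀ a ∈ S, K (t, a) = H (t, a) := by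
  have hσ : Continuous fun p : I × A => (unitInterval.symm p.1, p.2) := by fun_prop
  obtain ⟨K, hK0, hKS⟩ := h.extend hS b (fun p => H (unitInterval.symm p.1, p.2))
    (hH.comp hσ.continuousOn fun p hp => ⟨trivial, hp.2⟩) (by simpa using h1)
  refine ⟨K.comp ⟨_, hσ⟩, fun a => by simp [hK0], fun t a ha => by simp [hKS _ a ha]⟩

theorem HasHEP.of_homeomorph {A B : Type*} [TopologicalSpace A] [TopologicalSpace B]
    (e : A ≃ₜ B) {S : Set A} {T : Set B} (hST : ∀ a, a ∈ S ↔ e a ∈ T) (h : HasHEP T) :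
    HasHEP S := by
  obtain ⟨r, hr, hr0, hrS⟩ := h
  refine ⟨⟨fun p => ((r (p.1, e p.2)).1, e.symm (r (p.1, e p.2)).2), by fun_prop⟩, fun p => ?_,
    fun a => by simp [hr0], fun t a ha => ?_⟩
  · rcases hr (p.1, e p.2) with h | h
    · exact Or.inl h
    · exact Or.inr ((hST _).2 (by simpa using h))
  · simp [hrS t _ ((hST a).1 ha)]

theorem isClosed_cubeBoundary (n : ℕ) : IsClosed (Cube.boundary (Fin n)) := by
  have : Cube.boundary (Fin n) = ⋃ i, {y : Fin n → I | y i = 0 ∨ y i = 1} := by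
    ext y; simp [Cube.boundary]
  rw [this]
  refine isClosed_iUnion_of_finite fun i => ?_
  exact (isClosed_eq (continuous_apply i) continuous_const).union
    (isClosed_eq (continuous_apply i) continuous_const)

/-- Centre the cube as `[-1, 1]^n` with the sup norm and put `y = (1 + t)(2s - 1)`. The retraction
sends `(t, s)` to time `max 0 (‖y‖ - 1)` and centred position `y / max 1 ‖y‖`. If `‖y‖ ≤ 1` the time
is `0`; otherwise the position has norm `1` and lies on the boundary. Over the boundary `‖y‖ = 1 +
t`, so points there are fixed. -/
theorem hasHEP_cubeBoundary (n : ℕ) : HasHEP (Cube.boundary (Fin n)) := by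
  let y : I × (Fin n → I) → Fin n → ℝ := fun p i => (1 + (p.1 : ℝ)) * (2 * (p.2 i : ℝ) - 1)
  have hy : Continuous y := by fun_prop
  let N : I × (Fin n → I) → ℝ := fun p => ‖y p‖
  have hN : Continuous N := hy.norm
  have hx : ∀ (s : Fin n → I) i, |2 * (s i : ℝ) - 1| ≤ 1 := fun s i => by
    rw [abs_le]; constructor <;> linarith [(s i).2.1, (s i).2.2]
  have hyi : ∀ p i, |y p i| = (1 + (p.1 : ℝ)) * |2 * (p.2 i : ℝ) - 1| := fun p i => by
    rw [abs_mul, abs_of_nonneg (by linarith [p.1.2.1])]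
  have hNle : ∀ p, N p ≤ 1 + p.1 := fun p => by
    refine (pi_norm_le_iff_of_nonneg (by linarith [p.1.2.1])).2 fun i => ?_
    rw [Real.norm_eq_abs, hyi]
    nlinarith [hx p.2 i, p.1.2.1]
  have hyN : ∀ p i, |y p i| ≤ N p := fun p i => norm_le_pi_norm (y p) i
  have hm : ∀ p, 0 < max 1 (N p) := fun p => lt_max_of_lt_left one_pos
  have hq : ∀ p i, |y p i / max 1 (N p)| ≤ 1 := fun p i => by
    rw [abs_div, abs_of_pos (hm p), div_le_one (hm p)]
    exact (hyN p i).trans (le_max_right _ _)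
  have hbd : ∀ (s : Fin n → I) i, s i = 0 ∨ s i = 1 ↔ |2 * (s i : ℝ) - 1| = 1 := fun s i => by
    rw [abs_eq one_pos.le, Subtype.ext_iff, Subtype.ext_iff, Set.Icc.coe_zero, Set.Icc.coe_one]
    constructor
    · rintro (h | h) <;> rw [h] <;> norm_num
    · rintro (h | h)
      · right; linarith
      · left; linarith
  refine ⟨⟨fun p => (⟨max 0 (N p - 1), le_max_left _ _, max_le zero_le_one
      (by linarith [hNle p, p.1.2.2])⟩, fun i => ⟨(y p i / max 1 (N p) + 1) / 2, ?_, ?_⟩), ?_⟩,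
      fun p => ?_, fun s => ?_, fun t s hs => ?_⟩
  · linarith [(abs_le.1 (hq p i)).1]
  · linarith [(abs_le.1 (hq p i)).2]
  · refine Continuous.prodMk (Continuous.subtype_mk (by fun_prop) _)
      (continuous_pi fun i => Continuous.subtype_mk ?_ _)
    refine Continuous.div_const (Continuous.add (Continuous.div (by fun_prop) (by fun_prop)
      fun p => (hm p).ne') continuous_const) _
  · rcases le_or_gt (N p) 1 with h | h
    · left
      exact Subtype.ext (max_eq_left (by linarith))
    · right
      have hn : Nonempty (Fin n) := by
        by_contra hn
        rw [not_nonempty_iff] at hn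
        have : N p = 0 := by simp [N, Subsingleton.elim (y p) 0]
        linarith
      obtain ⟨i, hi⟩ : ∃ i, |y p i| = N p := by
        obtain ⟨i, hi⟩ := Finite.exists_max fun i => |y p i|
        exact ⟨i, le_antisymm (hyN p i) ((pi_norm_le_iff_of_nonneg (abs_nonneg _)).2 hi)⟩
      refine ⟨i, ?_⟩
      rw [hbd]
      simp only [ContinuousMap.coe_mk]
      rw [show 2 * ((y p i / max 1 (N p) + 1) / 2) - 1 = y p i / max 1 (N p) by ring, abs_div,
        abs_of_pos (hm p), hi, max_eq_right h.le, div_self (by linarith)]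
  · have h1 : N (0, s) ≤ 1 := by simpa using hNle (0, s)
    refine Prod.ext (Subtype.ext (max_eq_left (by linarith))) (funext fun i => Subtype.ext ?_)
    simp only [ContinuousMap.coe_mk]
    rw [max_eq_left h1]
    simp [y]
  · obtain ⟨i, hi⟩ := hs
    have h1 : N (t, s) = 1 + t := le_antisymm (hNle _) (by
      have := hyN (t, s) i
      rwa [hyi, (hbd s i).1 hi, mul_one] at this)
    have h0 : (0 : ℝ) ≤ t := t.2.1
    refine Prod.ext (Subtype.ext ?_) (funext fun i => Subtype.ext ?_)
    · simp only [ContinuousMap.coe_mk, h1]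
      rw [max_eq_right (by linarith)]; ring
    · simp only [ContinuousMap.coe_mk, h1, y]
      rw [max_eq_right (by linarith)]
      field_simp
      ring

/-- The homeomorphism `I × I^n ≃ₜ I^{n+1}`; the first factor becomes the first coordinate. -/
def consCube (n : ℕ) : I × (Fin n → I) ≃ₜ (Fin (n + 1) → I) where
  toFun p := Fin.cons p.1 p.2
  invFun v := (v 0, Fin.tail v)
  left_inv p := by simp
  right_inv v := by simp
  continuous_toFun := by
    refine continuous_pi fun i => ?_
    refine Fin.cases ?_ (fun j => ?_) i
    · simpa using continuous_fst
    · simpa using! (continuous_apply j).comp continuous_snd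
  continuous_invFun := (continuous_apply 0).prodMk
    (continuous_pi fun i => continuous_apply i.succ)

@[simp]
theorem consCube_apply (n : ℕ) (p : I × (Fin n → I)) :
    consCube n p = (Fin.cons p.1 p.2 : Fin (n + 1) → I) := rfl

/-- The ends of the cylinder `I × A`, together with the part of the cylinder over `S`. -/
def cylBoundary {A : Type*} (S : Set A) : Set (I × A) :=
  {p | p.1 = 0 ∨ p.1 = 1 ∨ p.2 ∈ S}

/-- The boundary of the cube `I × I^n`. -/
abbrev prismBoundary (n : ℕ) : Set (I × (Fin n → I)) := cylBoundary (Cube.boundary (Fin n))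

theorem cons_mem_boundary_iff {n : ℕ} {t : I} {s : Fin n → I} :
    (Fin.cons t s : Fin (n + 1) → I) ∈ Cube.boundary (Fin (n + 1)) ↔
      (t, s) ∈ prismBoundary n := by
  simp [Cube.boundary, cylBoundary, Fin.exists_fin_succ, or_assoc]

theorem mem_boundary_succ_iff {n : ℕ} {v : Fin (n + 1) → I} :
    v ∈ Cube.boundary (Fin (n + 1)) ↔ (v 0, Fin.tail v) ∈ prismBoundary n := by
  rw [← cons_mem_boundary_iff, Fin.cons_self_tail]

theorem isClosed_cylBoundary {A : Type*} [TopologicalSpace A] {S : Set A} (hS : IsClosed S) :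
    IsClosed (cylBoundary S) :=
  (isClosed_eq continuous_fst continuous_const).union
    ((isClosed_eq continuous_fst continuous_const).union (hS.preimage continuous_snd))

theorem isClosed_prismBoundary (n : ℕ) : IsClosed (prismBoundary n) :=
  isClosed_cylBoundary (isClosed_cubeBoundary n)

theorem hasHEP_prismBoundary (n : ℕ) : HasHEP (prismBoundary n) :=
  (hasHEP_cubeBoundary (n + 1)).of_homeomorph (consCube n) fun p => by
    rw [consCube_apply, cons_mem_boundary_iff]

/-- The cylinder on a prism is a prism of one dimension more, with the corresponding boundary. This
allows homotopies between maps of prisms to be deformed with both ends fixed. -/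
theorem hasHEP_cylBoundary_prismBoundary (n : ℕ) : HasHEP (cylBoundary (prismBoundary n)) :=
  (hasHEP_prismBoundary (n + 1)).of_homeomorph (T := prismBoundary (n + 1))
    ((Homeomorph.refl I).prodCongr (consCube n)) fun _ => or_congr Iff.rfl (or_congr Iff.rfl cons_mem_boundary_iff.symm)

end NilHtpy

namespace NilHtpy

/-! ### Relative lifting of prisms along a weak equivalence -/

/-- A continuous map that induces bijections on all homotopy groups at all base points. -/
def IsWeakEquiv {Y Z : Type u} [TopologicalSpace Y] [TopologicalSpace Z] (f : C(Y, Z)) : Prop :=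
  ∀ (n : ℕ) (y : Y), Function.Bijective (homotopyGroupMap n f y)

section

variable {Y Z : Type u} [TopologicalSpace Y] [TopologicalSpace Z]

theorem homotopyGroupMap_injective_iff {n : ℕ} {f : C(Y, Z)} {y : Y} :
    Function.Injective (homotopyGroupMap n f y) ↔ ∀ p q : Ω^ (Fin n) Y y,
      (f.comp p.1).HomotopicRel (f.comp q.1) (Cube.boundary (Fin n)) →
        p.1.HomotopicRel q.1 (Cube.boundary (Fin n)) := by
  constructor
  · intro h p q hpq
    exact Quotient.exact (@h ⟦p⟧ ⟦q⟧ (Quotient.sound hpq))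
  · intro h a b
    refine Quotient.inductionOn₂ a b fun p q hpq => Quotient.sound (h p q (Quotient.exact hpq))

theorem homotopyGroupMap_surjective_iff {n : ℕ} {f : C(Y, Z)} {y : Y} :
    Function.Surjective (homotopyGroupMap n f y) ↔ ∀ q : Ω^ (Fin n) Z (f y),
      ∃ p : Ω^ (Fin n) Y y, (f.comp p.1).HomotopicRel q.1 (Cube.boundary (Fin n)) := by
  constructor
  · intro h q
    obtain ⟨a, ha⟩ := h ⟦q⟧
    induction a using Quotient.inductionOn with
    | h p => exact ⟨p, Quotient.exact ha⟩
  · intro h b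
    induction b using Quotient.inductionOn with
    | h q =>
      obtain ⟨p, hp⟩ := h q
      exact ⟨⟦p⟧, Quotient.sound hp⟩

variable {k : ℕ} {z : Z}

/-- A path in the space of `k`-dimensional loops, as a map on the prism `I × I^k`. -/
def prismOfPath {g₀ g₁ : Ω^ (Fin k) Z z} (p : Path g₀ g₁) : C(I × (Fin k → I), Z) :=
  ⟨fun v => p v.1 v.2, by fun_prop⟩

@[simp]
theorem prismOfPath_apply {g₀ g₁ : Ω^ (Fin k) Z z} (p : Path g₀ g₁) (t : I) (s : Fin k → I) :
    prismOfPath p (t, s) = p t s := rfl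

/-- A map on the prism `I × I^k` that is constant on `I × ∂I^k`, as a path of
`k`-dimensional loops. -/
def pathOfPrism (K : C(I × (Fin k → I), Z)) (hK : ∀ t, ∀ s ∈ Cube.boundary (Fin k), K (t, s) = z)
    {g₀ g₁ : Ω^ (Fin k) Z z} (h₀ : ∀ s, K (0, s) = g₀ s) (h₁ : ∀ s, K (1, s) = g₁ s) :
    Path g₀ g₁ where
  toFun t := ⟨K.curry t, hK t⟩
  continuous_toFun := K.curry.continuous.subtype_mk _
  source' := GenLoop.ext _ _ h₀
  target' := GenLoop.ext _ _ h₁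

/-- Together with `homotopic_of_prismOfPath` this turns relative homotopies of prisms into
homotopies of paths in the `k`-fold loop space, where the groupoid laws for paths are available. -/
theorem prismOfPath_homotopicRel {g₀ g₁ : Ω^ (Fin k) Z z} {p q : Path g₀ g₁}
    (h : p.Homotopic q) :
    (prismOfPath p).HomotopicRel (prismOfPath q) (prismBoundary k) := by
  obtain ⟨F⟩ := h
  refine ⟨⟨⟨⟨fun v => F (v.1, v.2.1) v.2.2, by fun_prop⟩, fun v => by simp [prismOfPath],
    fun v => by simp [prismOfPath]⟩, ?_⟩⟩
  rintro t ⟨τ, s⟩ (h | h | h)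
  · simp only [ContinuousMap.coe_mk] at h ⊢
    subst h; simp
  · simp only [ContinuousMap.coe_mk] at h ⊢
    subst h; simp
  · simp only [ContinuousMap.coe_mk] at h ⊢
    rw [GenLoop.boundary _ _ h]; exact (GenLoop.boundary _ _ h).symm

theorem homotopic_of_prismOfPath {g₀ g₁ : Ω^ (Fin k) Z z} {p q : Path g₀ g₁}
    (h : (prismOfPath p).HomotopicRel (prismOfPath q) (prismBoundary k)) : p.Homotopic q := by
  obtain ⟨F⟩ := h
  have hF : ∀ (v : I × I) (s : Fin k → I), s ∈ Cube.boundary (Fin k) →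
      F (v.1, (v.2, s)) = z := fun v s hs => by
    rw [F.eq_fst _ (Or.inr (Or.inr hs))]
    exact GenLoop.boundary _ _ hs
  let G : C((I × I) × (Fin k → I), Z) := ⟨fun w => F (w.1.1, (w.1.2, w.2)), by fun_prop⟩
  refine ⟨⟨⟨⟨fun v => ⟨G.curry v, hF v⟩, G.curry.continuous.subtype_mk _⟩,
    fun t => GenLoop.ext _ _ fun s => F.apply_zero (t, s),
    fun t => GenLoop.ext _ _ fun s => F.apply_one (t, s)⟩, ?_⟩⟩
  rintro t τ (h | h)
  · subst h
    exact GenLoop.ext _ _ fun s => F.eq_fst t (x := (0, s)) (Or.inl rfl)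
  · obtain rfl := Set.mem_singleton_iff.1 h
    exact GenLoop.ext _ _ fun s => F.eq_fst t (x := (1, s)) (Or.inr (Or.inl rfl))

/-- The map of spaces of `k`-dimensional loops induced by a continuous map. -/
def genLoopMap (f : C(Y, Z)) (k : ℕ) (y : Y) : C(Ω^ (Fin k) Y y, Ω^ (Fin k) Z (f y)) :=
  ⟨fun p => ⟨f.comp p.1, fun s hs => congrArg f (p.2 s hs)⟩,
    ((ContinuousMap.continuous_postcomp f).comp continuous_subtype_val).subtype_mk _⟩

theorem prismOfPath_map (f : C(Y, Z)) {y : Y} {g₀ g₁ : Ω^ (Fin k) Y y} (p : Path g₀ g₁) :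
    prismOfPath (p.map (genLoopMap f k y).continuous) = f.comp (prismOfPath p) := rfl

/-- A loop of `k`-dimensional loops at the constant one is an element of `π_{k+1}`, so this is
surjectivity on `π_{k+1}`. -/
theorem IsWeakEquiv.exists_loop {f : C(Y, Z)} (hf : IsWeakEquiv f) {y : Y}
    (q : Path (genLoopMap f k y GenLoop.const) (genLoopMap f k y GenLoop.const)) :
    ∃ p : Path (GenLoop.const : Ω^ (Fin k) Y y) GenLoop.const,
      (p.map (genLoopMap f k y).continuous).Homotopic q := by
  have hq : ∀ v ∈ prismBoundary k, prismOfPath q v = f y := by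
    rintro ⟨t, s⟩ (h | h | h)
    · obtain rfl : t = 0 := h
      exact congrArg (fun g : Ω^ (Fin k) Z (f y) => g s) q.source
    · obtain rfl : t = 1 := h
      exact congrArg (fun g : Ω^ (Fin k) Z (f y) => g s) q.target
    · exact GenLoop.boundary _ _ h
  obtain ⟨p, ⟨F⟩⟩ := homotopyGroupMap_surjective_iff.1 (hf (k + 1) y).2
    ⟨(prismOfPath q).comp ⟨(consCube k).symm, (consCube k).symm.continuous⟩, fun v hv =>
      hq _ (mem_boundary_succ_iff.1 hv)⟩
  have hp : ∀ v ∈ prismBoundary k, p.1 (consCube k v) = y := fun v hv =>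
    p.2 _ (cons_mem_boundary_iff.2 hv)
  let e : C(I × (Fin k → I), Fin (k + 1) → I) := ⟨consCube k, (consCube k).continuous⟩
  refine ⟨pathOfPrism (p.1.comp e) (fun t s hs => hp (t, s) (Or.inr (Or.inr hs)))
    (fun s => hp (0, s) (Or.inl rfl)) (fun s => hp (1, s) (Or.inr (Or.inl rfl))),
    homotopic_of_prismOfPath ?_⟩
  rw [prismOfPath_map]
  change (f.comp (p.1.comp e)).HomotopicRel _ _
  refine ⟨⟨⟨⟨fun v => F (v.1, consCube k v.2), by fun_prop⟩, fun v => ?_, fun v => ?_⟩, ?_⟩⟩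
  · exact F.apply_zero _
  · refine (F.apply_one _).trans (congrArg (prismOfPath q) ?_)
    exact (consCube k).symm_apply_apply v
  · intro t v hv
    exact F.eq_fst t (cons_mem_boundary_iff.2 hv)

/-- Solution of the relative lifting problem for a prism whose boundary datum is constant outside
of the face `{1} × I^k`. -/
theorem IsWeakEquiv.exists_prism {f : C(Y, Z)} (hf : IsWeakEquiv f) {y : Y}
    (a : Ω^ (Fin k) Y y) (b : C(I × (Fin k → I), Z)) (h0 : ∀ s, b (0, s) = f y)
    (h1 : ∀ s, b (1, s) = f (a s)) (hb : ∀ t, ∀ s ∈ Cube.boundary (Fin k), b (t, s) = f y) :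
    ∃ c : C(I × (Fin k → I), Y), (∀ s, c (0, s) = y) ∧ (∀ s, c (1, s) = a s) ∧
      (∀ t, ∀ s ∈ Cube.boundary (Fin k), c (t, s) = y) ∧
      (f.comp c).HomotopicRel b (prismBoundary k) := by
  let B : Path (genLoopMap f k y GenLoop.const) (genLoopMap f k y a) := pathOfPrism b hb h0 h1
  -- Injectivity on `π_k` gives some path `c₁` from the constant loop to `a`, but its image need not
  -- be homotopic to `B`. The discrepancy is the loop `B · (f c₁)⁻¹`, which lifts up to homotopy to
  -- a loop `p`; then `p · c₁` has image homotopic to `B`.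
  obtain ⟨F⟩ := homotopyGroupMap_injective_iff.1 (hf k y).1 GenLoop.const a
    ⟨⟨⟨b, h0, h1⟩, fun t s hs => hb t s hs⟩⟩
  let c₁ : Path (GenLoop.const : Ω^ (Fin k) Y y) a :=
    pathOfPrism F.toContinuousMap (fun t s hs => F.eq_fst t hs) F.apply_zero F.apply_one
  obtain ⟨p, hp⟩ := hf.exists_loop (B.trans (c₁.map (genLoopMap f k y).continuous).symm)
  refine ⟨prismOfPath (p.trans c₁), fun s => ?_, fun s => ?_, fun t s hs => ?_, ?_⟩
  · simp
  · simp
  · exact GenLoop.boundary _ _ hs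
  · rw [← prismOfPath_map]
    refine prismOfPath_homotopicRel (q := B) ?_
    rw [Path.map_trans]
    refine (Path.Homotopic.hcomp hp (Path.Homotopic.refl _)).trans ?_
    rw [← Path.Homotopic.Quotient.eq]
    simp only [Path.Homotopic.Quotient.mk_trans, Path.Homotopic.Quotient.mk_symm,
      Path.Homotopic.Quotient.trans_assoc, Path.Homotopic.Quotient.symm_trans,
      Path.Homotopic.Quotient.trans_refl]

end

end NilHtpy

namespace NilHtpy

/-! ### Homotopies with a prescribed track -/

section

variable {A Y Z : Type*} [TopologicalSpace A] [TopologicalSpace Y] [TopologicalSpace Z]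

theorem homotopy_trans_track {g₀ g₁ g₂ : C(A, Z)} (F : g₀.Homotopy g₁) (G : g₁.Homotopy g₂)
    (T : I → Z) {t₀ t₁ t₂ : I} (η : Path t₀ t₁) (ζ : Path t₁ t₂) {a : A}
    (hF : ∀ t, F (t, a) = T (η t)) (hG : ∀ t, G (t, a) = T (ζ t)) (t : I) :
    (F.trans G) (t, a) = T ((η.trans ζ) t) := by
  rw [ContinuousMap.Homotopy.trans_apply, Path.trans_apply]
  split_ifs <;> simp [hF, hG]

/-- The identity of the interval, as a path. -/
def idPath : Path (0 : I) 1 := ⟨ContinuousMap.id I, rfl, rfl⟩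

@[simp]
theorem idPath_apply (t : I) : idPath t = t := rfl

/-- A homotopy whose track on `S` runs forth and back can be replaced by one relative to `S`. -/
theorem homotopicRel_of_track {S : Set A} (hS : IsClosed S) (hep : HasHEP (cylBoundary S))
    {g₀ g₁ : C(A, Z)} (K : g₀.Homotopy g₁) (T : I × A → Z)
    (hT : ContinuousOn T (Set.univ ×ˢ S)) (η : Path (0 : I) 0)
    (hK : ∀ t, ∀ a ∈ S, K (t, a) = T (η t, a)) : g₀.HomotopicRel g₁ S := by
  classical
  -- Over `S` the track `η` is contracted to `0` by the factor `1 - w`, while the ends `g₀` and `g₁`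
  -- stay fixed. Extending this deformation from the boundary of the cylinder to `K`, the stage `w =
  -- 1` is stationary on `S`.
  let N : I × (I × A) → Z := fun p =>
    if p.2.1 = 0 then g₀ p.2.2 else if p.2.1 = 1 then g₁ p.2.2
      else T (unitInterval.symm p.1 * η p.2.1, p.2.2)
  have h₀ : ∀ a ∈ S, T (0, a) = g₀ a := fun a ha => by simpa using (hK 0 a ha).symm
  have h₁ : ∀ a ∈ S, T (0, a) = g₁ a := fun a ha => by simpa using (hK 1 a ha).symm
  have hNS : ∀ w t, ∀ a ∈ S, N (w, (t, a)) = T (unitInterval.symm w * η t, a) := by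
    intro w t a ha
    by_cases ht0 : t = 0
    · subst ht0; simp [N, h₀ a ha]
    by_cases ht1 : t = 1
    · subst ht1; simp [N, h₁ a ha]
    simp [N, ht0, ht1]
  have hN : ContinuousOn N (Set.univ ×ˢ cylBoundary S) := by
    have hset : (Set.univ : Set I) ×ˢ cylBoundary S =
        {p | p.2.1 = 0} ∪ ({p | p.2.1 = 1} ∪ {p | p.2.2 ∈ S}) := by
      ext p; simp [cylBoundary]
    have hc : Continuous fun p : I × (I × A) => p.2.1 := by fun_prop
    have c0 : IsClosed {p : I × (I × A) | p.2.1 = 0} := isClosed_eq hc continuous_const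
    have c1 : IsClosed {p : I × (I × A) | p.2.1 = 1} := isClosed_eq hc continuous_const
    have cS : IsClosed {p : I × (I × A) | p.2.2 ∈ S} := hS.preimage (by fun_prop)
    rw [hset]
    refine ContinuousOn.union_of_isClosed ?_ (ContinuousOn.union_of_isClosed ?_ ?_ c1 cS) c0
      (c1.union cS)
    · refine (Continuous.continuousOn (f := fun p : I × (I × A) => g₀ p.2.2)
        (by fun_prop)).congr fun p hp => ?_
      simp only [Set.mem_ofPred_eq] at hp
      simp [N, hp]
    · refine (Continuous.continuousOn (f := fun p : I × (I × A) => g₁ p.2.2)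
        (by fun_prop)).congr fun p hp => ?_
      simp only [Set.mem_ofPred_eq] at hp
      simp [N, hp]
    · refine (hT.comp (f := fun p : I × (I × A) => (unitInterval.symm p.1 * η p.2.1, p.2.2))
        (Continuous.continuousOn (by fun_prop)) fun p hp => ⟨trivial, hp⟩).congr fun p hp => ?_
      exact hNS _ _ _ hp
  obtain ⟨M, -, hM⟩ := hep.extend (isClosed_cylBoundary hS) K.toContinuousMap N hN (by
    rintro ⟨t, a⟩ (h | h | h)
    · obtain rfl : t = 0 := h
      simp [N]
    · obtain rfl : t = 1 := h
      simp [N]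
    · rw [hNS _ _ _ h]
      simpa using (hK t a h).symm)
  refine ⟨⟨⟨⟨fun p => M (1, p), by fun_prop⟩, fun a => ?_, fun a => ?_⟩, fun t a ha => ?_⟩⟩
  · exact (hM 1 (0, a) (Or.inl rfl)).trans (by simp [N])
  · exact (hM 1 (1, a) (Or.inr (Or.inl rfl))).trans (by simp [N])
  · refine (hM 1 (t, a) (Or.inr (Or.inr ha))).trans ((hNS _ _ _ ha).trans ?_)
    simp [h₀ a ha]

/-- Solvability of a relative lifting problem is invariant under homotopies of the data. -/
theorem exists_relLift_of_homotopy {S : Set A} (hS : IsClosed S) (hepS : HasHEP S)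
    (hep : HasHEP (cylBoundary S)) (f : C(Y, Z)) (T : I × A → Y)
    (hT : ContinuousOn T (Set.univ ×ˢ S)) (b : C(A, Z)) (hb : ∀ a ∈ S, b a = f (T (0, a)))
    (H : ∀ b' : C(A, Z), (∀ a ∈ S, b' a = f (T (1, a))) →
      ∃ c : C(A, Y), (∀ a ∈ S, c a = T (1, a)) ∧ (f.comp c).HomotopicRel b' S) :
    ∃ c : C(A, Y), (∀ a ∈ S, c a = T (0, a)) ∧ (f.comp c).HomotopicRel b S := by
  obtain ⟨B, hB0, hBS⟩ := hepS.extend hS b (fun p => f (T p)) (f.continuous.comp_continuousOn hT)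
    fun a ha => (hb a ha).symm
  let b' : C(A, Z) := ⟨fun a => B (1, a), by fun_prop⟩
  obtain ⟨c', hc', ⟨F⟩⟩ := H b' fun a ha => hBS 1 a ha
  obtain ⟨C, hC1, hCS⟩ := hepS.extend_one hS c' T hT fun a ha => (hc' a ha).symm
  let c : C(A, Y) := ⟨fun a => C (0, a), by fun_prop⟩
  let K₁ : (f.comp c).Homotopy (f.comp c') := ⟨f.comp C, fun a => rfl, fun a => by simp [hC1]⟩
  let K₃ : b.Homotopy b' := ⟨B, hB0, fun a => rfl⟩
  refine ⟨c, fun a ha => hCS 0 a ha, ?_⟩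
  -- Over `S` the composite homotopy runs along `f ∘ T` from `0` to `1`, waits at `1` and returns,
  -- so its track is a loop at `0` in the interval.
  refine homotopicRel_of_track hS hep ((K₁.trans F.toHomotopy).trans K₃.symm) (fun p => f (T p))
    (f.continuous.comp_continuousOn hT) ((idPath.trans (Path.refl 1)).trans idPath.symm) ?_
  intro t a ha
  refine homotopy_trans_track _ _ (fun τ => f (T (τ, a))) _ _ (fun t => ?_) (fun t => ?_) t
  · refine homotopy_trans_track _ _ (fun τ => f (T (τ, a))) _ _ (fun t => ?_) (fun t => ?_) t
    · exact congrArg f (hCS t a ha)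
    · refine (F.eq_fst t ha).trans ?_
      simp [hc' a ha]
  · exact hBS _ a ha

end

/-! ### Relative lifting over prisms and the homotopy extension lifting property -/

section

variable {Y Z : Type u} [TopologicalSpace Y] [TopologicalSpace Z] {k : ℕ}

/-- Any map on the boundary of the prism `I × I^k` is homotopic to a map that is constant outside
of the face `{1} × I^k`. -/
theorem exists_homotopy_to_face (a : I × (Fin k → I) → Y)
    (ha : ContinuousOn a (prismBoundary k)) :
    ∃ T : I × (I × (Fin k → I)) → Y, ContinuousOn T (Set.univ ×ˢ prismBoundary k) ∧
      (∀ v ∈ prismBoundary k, T (0, v) = a v) ∧ ∃ y, (∀ s, T (1, (0, s)) = y) ∧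
        ∀ t, ∀ s ∈ Cube.boundary (Fin k), T (1, (t, s)) = y := by
  classical
  obtain ⟨r, hr, hr0, hrS⟩ := hasHEP_cubeBoundary k
  -- The image of `r` is the open box `{0} × I^k ∪ I × ∂I^k`, the prism boundary without the
  -- interior of the face `{1} × I^k`. Scaling the prism linearly to its corner and applying `r`
  -- contracts this box within itself to `(0, 0)`.
  let D : C(I × (I × (Fin k → I)), I × (Fin k → I)) :=
    ⟨fun p => r (unitInterval.symm p.1 * p.2.1, fun i => unitInterval.symm p.1 * p.2.2 i),
      by fun_prop⟩
  have hr' : ∀ v, r v ∈ prismBoundary k := fun v => (hr v).elim Or.inl fun h => Or.inr (Or.inr h)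
  have haD : Continuous fun p => a (D p) := ha.comp_continuous D.continuous fun p => hr' _
  have hD1 : ∀ v, D (1, v) = (0, 0) := fun v => by
    simp only [D, ContinuousMap.coe_mk, unitInterval.symm_one, zero_mul]
    exact hr0 0
  have hD0 : ∀ v, D (0, v) = r v := fun v => by simp [D]
  -- On the remaining face the contraction is known only over `∂I^k`; it is extended over the face
  -- by homotopy extension.
  obtain ⟨A₁, hA0, hAS⟩ := (hasHEP_cubeBoundary k).extend (isClosed_cubeBoundary k)
    ⟨fun s => a (1, s), ha.comp_continuous (by fun_prop) fun s => Or.inr (Or.inl rfl)⟩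
    (fun p => a (D (p.1, (1, p.2)))) (haD.comp (by fun_prop)).continuousOn
    (fun s hs => by
      simp only [hD0, ContinuousMap.coe_mk]
      rw [hrS 1 s hs])
  let T : I × (I × (Fin k → I)) → Y := fun p => if p.2.1 = 1 then A₁ (p.1, p.2.2) else a (D p)
  have hT0 : ∀ w s, T (w, (0, s)) = a (D (w, (0, s))) := fun w s => by simp [T]
  have hTS : ∀ w t, ∀ s ∈ Cube.boundary (Fin k), T (w, (t, s)) = a (D (w, (t, s))) := by
    intro w t s hs
    by_cases ht : t = 1
    · subst ht; simp [T, hAS w s hs]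
    · simp [T, ht]
  refine ⟨T, ?_, ?_, a (0, 0), fun s => by rw [hT0, hD1], fun t s hs => by rw [hTS _ _ _ hs, hD1]⟩
  · have hset : (Set.univ : Set I) ×ˢ prismBoundary k =
        {p | p.2.1 = 1} ∪ {p | p.2.1 = 0 ∨ p.2.2 ∈ Cube.boundary (Fin k)} := by
      ext p
      simp only [cylBoundary, Set.mem_prod, Set.mem_univ, Set.mem_ofPred_eq, true_and,
        Set.mem_union]
      tauto
    have hc : Continuous fun p : I × (I × (Fin k → I)) => p.2.1 := by fun_prop
    rw [hset]
    refine ContinuousOn.union_of_isClosed ?_ ?_ (isClosed_eq hc continuous_const)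
      ((isClosed_eq hc continuous_const).union ((isClosed_cubeBoundary k).preimage (by fun_prop)))
    · refine (Continuous.continuousOn (f := fun p : I × (I × (Fin k → I)) => A₁ (p.1, p.2.2))
        (by fun_prop)).congr fun p hp => ?_
      simp only [Set.mem_ofPred_eq] at hp
      simp [T, hp]
    · refine haD.continuousOn.congr ?_
      rintro ⟨w, t, s⟩ (h | h)
      · obtain rfl : t = 0 := h
        exact hT0 w s
      · exact hTS w t s h
  · rintro ⟨t, s⟩ (h | h | h)
    · obtain rfl : t = 0 := h
      rw [hT0, hD0, hr0]
    · obtain rfl : t = 1 := h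
      simp [T, hA0]
    · rw [hTS _ _ _ h, hD0, hrS t s h]

/-- The boundary datum is deformed until it is constant outside the face `{1} × I^k`, where
`exists_prism` applies; solvability of the lifting problem is invariant under such a deformation. -/
theorem IsWeakEquiv.exists_relLift_prism {f : C(Y, Z)} (hf : IsWeakEquiv f)
    (a : I × (Fin k → I) → Y) (ha : ContinuousOn a (prismBoundary k)) (b : C(I × (Fin k → I), Z))
    (hb : ∀ v ∈ prismBoundary k, b v = f (a v)) :
    ∃ c : C(I × (Fin k → I), Y), (∀ v ∈ prismBoundary k, c v = a v) ∧
      (f.comp c).HomotopicRel b (prismBoundary k) := by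
  obtain ⟨T, hT, hT0, y, hy0, hyS⟩ := exists_homotopy_to_face a ha
  obtain ⟨c, hc, hcb⟩ := exists_relLift_of_homotopy (isClosed_prismBoundary k)
    (hasHEP_prismBoundary k) (hasHEP_cylBoundary_prismBoundary k) f T hT b
    (fun v hv => by rw [hb v hv, hT0 v hv]) (fun b' hb' => by
      let g : Ω^ (Fin k) Y y := ⟨⟨fun s => T (1, (1, s)), hT.comp_continuous (by fun_prop)
        fun s => ⟨trivial, Or.inr (Or.inl rfl)⟩⟩, fun s hs => hyS 1 s hs⟩
      obtain ⟨c, hc0, hc1, hcS, hc⟩ := hf.exists_prism g b'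
        (fun s => by rw [hb' _ (Or.inl rfl), hy0]) (fun s => hb' _ (Or.inr (Or.inl rfl)))
        (fun t s hs => by rw [hb' _ (Or.inr (Or.inr hs)), hyS t s hs])
      refine ⟨c, ?_, hc⟩
      rintro ⟨t, s⟩ (h | h | h)
      · obtain rfl : t = 0 := h
        rw [hc0, hy0]
      · obtain rfl : t = 1 := h
        exact hc1 s
      · rw [hcS t s h, hyS t s h])
  exact ⟨c, fun v hv => by rw [hc v hv, hT0 v hv], hcb⟩

/-- The homotopy extension lifting property of `f` with respect to the pair `(I^n, ∂I^n)`, where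
the homotopy on the boundary is prescribed up to a reparametrization. -/
def HasHELP (f : C(Y, Z)) (n : ℕ) : Prop :=
  ∀ (a : (Fin n → I) → Y) (b : C(Fin n → I, Z)) (H : I × (Fin n → I) → Z),
    ContinuousOn a (Cube.boundary (Fin n)) →
    ContinuousOn H (Set.univ ×ˢ Cube.boundary (Fin n)) →
    (∀ s ∈ Cube.boundary (Fin n), H (0, s) = f (a s)) →
    (∀ s ∈ Cube.boundary (Fin n), H (1, s) = b s) →
    ∃ (c : C(Fin n → I, Y)) (K : C(I × (Fin n → I), Z)) (θ : Path (0 : I) 1),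
      (∀ s ∈ Cube.boundary (Fin n), c s = a s) ∧ (∀ s, K (0, s) = f (c s)) ∧
      (∀ s, K (1, s) = b s) ∧ ∀ t, ∀ s ∈ Cube.boundary (Fin n), K (t, s) = H (θ t, s)

/-- Dragging `b` back along `H` reduces to a target that agrees with `f ∘ a` on the boundary. The
final homotopy is a relative one followed by the dragging, so over the boundary it waits at `0`
before following `H`; this is the source of the reparametrization `θ`. In dimension `0` there is no
boundary and the claim is surjectivity on `π_0`; in dimension `k + 1` the cube is a prism. -/
theorem IsWeakEquiv.hasHELP [Nonempty Y] {f : C(Y, Z)} (hf : IsWeakEquiv f) (n : ℕ) :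
    HasHELP f n := by
  intro a b H ha hH hH0 hH1
  suffices hstrict : ∀ b₀ : C(Fin n → I, Z), (∀ s ∈ Cube.boundary (Fin n), b₀ s = f (a s)) →
      ∃ c : C(Fin n → I, Y), (∀ s ∈ Cube.boundary (Fin n), c s = a s) ∧
        (f.comp c).HomotopicRel b₀ (Cube.boundary (Fin n)) by
    obtain ⟨B, hB1, hBS⟩ := (hasHEP_cubeBoundary n).extend_one (isClosed_cubeBoundary n) b H hH hH1
    let b₀ : C(Fin n → I, Z) := ⟨fun s => B (0, s), by fun_prop⟩
    obtain ⟨c, hc, ⟨F⟩⟩ := hstrict b₀ fun s hs => by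
      simp only [b₀, ContinuousMap.coe_mk]
      rw [hBS 0 s hs, hH0 s hs]
    let G : b₀.Homotopy b := ⟨B, fun s => rfl, hB1⟩
    refine ⟨c, (F.toHomotopy.trans G).toContinuousMap, (Path.refl 0).trans idPath, hc,
      fun s => (F.toHomotopy.trans G).apply_zero s, fun s => (F.toHomotopy.trans G).apply_one s,
      fun t s hs => ?_⟩
    refine homotopy_trans_track _ _ (fun τ => H (τ, s)) _ _ (fun t => ?_) (fun t => ?_) t
    · refine (F.eq_fst t hs).trans ?_
      simp [hc s hs, hH0 s hs]
    · exact hBS t s hs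
  intro b₀ hb₀
  cases n with
  | zero =>
    have hempty : ∀ s : Fin 0 → I, s ∉ Cube.boundary (Fin 0) := by
      rintro s ⟨i, -⟩
      exact i.elim0
    obtain ⟨p, hp⟩ := homotopyGroupMap_surjective_iff.1 (hf 0 (Classical.arbitrary Y)).2
      ⟨b₀, fun s hs => absurd hs (hempty s)⟩
    exact ⟨p.1, fun s hs => absurd hs (hempty s), hp⟩
  | succ k =>
    have hmem : ∀ v ∈ prismBoundary k, consCube k v ∈ Cube.boundary (Fin (k + 1)) := fun v hv =>
      cons_mem_boundary_iff.2 hv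
    let e : C(I × (Fin k → I), Fin (k + 1) → I) := ⟨consCube k, (consCube k).continuous⟩
    let e' : C(Fin (k + 1) → I, I × (Fin k → I)) :=
      ⟨(consCube k).symm, (consCube k).symm.continuous⟩
    obtain ⟨c, hc, ⟨F⟩⟩ := hf.exists_relLift_prism (fun v => a (consCube k v))
      (ha.comp (consCube k).continuous.continuousOn hmem) (b₀.comp e)
      (fun v hv => hb₀ _ (hmem v hv))
    have hee : ∀ v, e (e' v) = v := (consCube k).apply_symm_apply
    refine ⟨c.comp e', fun v hv => ?_,
      ⟨⟨⟨⟨fun p => F (p.1, e' p.2), by fun_prop⟩, fun v => ?_, fun v => ?_⟩, fun t v hv => ?_⟩⟩⟩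
    · refine (hc _ (mem_boundary_succ_iff.1 hv)).trans (congrArg a ?_)
      exact (consCube k).apply_symm_apply v
    · exact F.apply_zero _
    · refine (F.apply_one _).trans ?_
      simp [hee]
    · exact F.eq_fst t (mem_boundary_succ_iff.1 hv)

end

end NilHtpy

namespace NilHtpy

/-! ### Free loop spaces and periodic maps of cubes -/

section

variable {Y Z : Type u} [TopologicalSpace Y] [TopologicalSpace Z]

/-- The free loop space. -/
abbrev FreeLoop (Y : Type u) [TopologicalSpace Y] : Type u := {γ : C(I, Y) // γ 0 = γ 1}

/-- The map of free loop spaces induced by a continuous map. -/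
def freeLoopMap (f : C(Y, Z)) : C(FreeLoop Y, FreeLoop Z) :=
  ⟨fun γ => ⟨f.comp γ.1, congrArg f γ.2⟩,
    ((ContinuousMap.continuous_postcomp f).comp continuous_subtype_val).subtype_mk _⟩

@[simp]
theorem freeLoopMap_apply (f : C(Y, Z)) (γ : FreeLoop Y) (t : I) :
    (freeLoopMap f γ).1 t = f (γ.1 t) := rfl

/-- A family of free loops parametrized by `A`, given by its uncurried form. -/
def freeLoopFamily {A : Type*} [TopologicalSpace A] (g : A → I → Y)
    (hg : Continuous fun p : A × I => g p.1 p.2) (h : ∀ a, g a 0 = g a 1) : C(A, FreeLoop Y) :=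
  ⟨fun a => ⟨⟨g a, hg.comp (continuous_const.prodMk continuous_id)⟩, h a⟩,
    (ContinuousMap.curry ⟨fun p : A × I => g p.1 p.2, hg⟩).continuous.subtype_mk _⟩

@[simp]
theorem freeLoopFamily_apply {A : Type*} [TopologicalSpace A] (g : A → I → Y)
    (hg : Continuous fun p : A × I => g p.1 p.2) (h : ∀ a, g a 0 = g a 1) (a : A) (t : I) :
    (freeLoopFamily g hg h a).1 t = g a t := rfl

theorem continuous_freeLoop_eval : Continuous fun p : FreeLoop Y × I => p.1.1 p.2 := by fun_prop

theorem continuousOn_freeLoop_eval {A : Type*} [TopologicalSpace A] {S : Set A}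
    {g : A → FreeLoop Y} (hg : ContinuousOn g S) {B : Type*} [TopologicalSpace B] {φ : B → A}
    {τ : B → I} (hφ : Continuous φ) (hτ : Continuous τ) {R : Set B} (hR : ∀ v ∈ R, φ v ∈ S) :
    ContinuousOn (fun v => (g (φ v)).1 (τ v)) R :=
  continuous_freeLoop_eval.comp_continuousOn
    ((hg.comp hφ.continuousOn hR).prodMk hτ.continuousOn)

/-- The homotopy extension lifting property passes to free loop spaces. -/
theorem HasHELP.freeLoop {f : C(Y, Z)} (hf : ∀ n, HasHELP f n) (n : ℕ) :
    HasHELP (freeLoopMap f) n := by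
  classical
  intro a b H ha hH hH0 hH1
  have ev0 : Continuous fun γ : FreeLoop Y => γ.1 0 := by fun_prop
  have ev0' : Continuous fun γ : FreeLoop Z => γ.1 0 := by fun_prop
  -- The problem is solved first for the base points of the free loops. A free loop is then filled
  -- in over `I × I^n`, with both end faces prescribed by this same solution so that the result
  -- closes up.
  obtain ⟨c₀, K₀, θ₀, hc₀, hK₀0, hK₀1, hK₀S⟩ := hf n (fun s => (a s).1 0)
    ⟨fun s => (b s).1 0, by fun_prop⟩ (fun p => (H p).1 0) (ev0.comp_continuousOn ha)
    (ev0'.comp_continuousOn hH) (fun s hs => by rw [hH0 s hs]; rfl) (fun s hs => by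
      rw [hH1 s hs]; rfl)
  let Tl : (Fin (n + 1) → I) → Fin n → I := Fin.tail
  have hTl : Continuous Tl := continuous_pi fun i => continuous_apply i.succ
  let a' : (Fin (n + 1) → I) → Y := fun v =>
    if v 0 = 0 ∨ v 0 = 1 then c₀ (Tl v) else (a (Tl v)).1 (v 0)
  let H' : I × (Fin (n + 1) → I) → Z := fun p =>
    if p.2 0 = 0 ∨ p.2 0 = 1 then K₀ (p.1, Tl p.2) else (H (θ₀ p.1, Tl p.2)).1 (p.2 0)
  have ha'0 : ∀ v : Fin (n + 1) → I, (v 0 = 0 ∨ v 0 = 1) → a' v = c₀ (Tl v) := fun v hv =>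
    if_pos hv
  have ha'S : ∀ v : Fin (n + 1) → I, Tl v ∈ Cube.boundary (Fin n) →
      a' v = (a (Tl v)).1 (v 0) := by
    intro v hv
    by_cases h : v 0 = 0 ∨ v 0 = 1
    · rw [ha'0 v h, hc₀ _ hv]
      rcases h with h | h
      · rw [h]
      · rw [h, (a (Tl v)).2]
    · exact if_neg h
  have hH'0 : ∀ t, ∀ v : Fin (n + 1) → I, (v 0 = 0 ∨ v 0 = 1) → H' (t, v) = K₀ (t, Tl v) :=
    fun t v hv => if_pos hv
  have hH'S : ∀ t, ∀ v : Fin (n + 1) → I, Tl v ∈ Cube.boundary (Fin n) →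
      H' (t, v) = (H (θ₀ t, Tl v)).1 (v 0) := by
    intro t v hv
    by_cases h : v 0 = 0 ∨ v 0 = 1
    · rw [hH'0 t v h, hK₀S _ _ hv]
      rcases h with h | h
      · rw [h]
      · rw [h, (H (θ₀ t, Tl v)).2]
    · exact if_neg h
  have hbd : ∀ v : Fin (n + 1) → I, v ∈ Cube.boundary (Fin (n + 1)) ↔
      (v 0 = 0 ∨ v 0 = 1) ∨ Tl v ∈ Cube.boundary (Fin n) := fun v => by
    rw [mem_boundary_succ_iff, or_assoc]; rfl
  have cl0 : IsClosed {v : Fin (n + 1) → I | v 0 = 0 ∨ v 0 = 1} :=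
    (isClosed_eq (continuous_apply 0) continuous_const).union
      (isClosed_eq (continuous_apply 0) continuous_const)
  have clS : IsClosed {v : Fin (n + 1) → I | Tl v ∈ Cube.boundary (Fin n)} :=
    (isClosed_cubeBoundary n).preimage hTl
  obtain ⟨c, K, θ, hc, hK0, hK1, hKS⟩ := hf (n + 1) a'
    ⟨fun v => (b (Tl v)).1 (v 0), by fun_prop⟩ H' (by
      rw [show Cube.boundary (Fin (n + 1)) = {v | v 0 = 0 ∨ v 0 = 1} ∪
        {v | Tl v ∈ Cube.boundary (Fin n)} from Set.ext hbd]
      refine ContinuousOn.union_of_isClosed ?_ ?_ cl0 clS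
      · exact (c₀.continuous.comp hTl).continuousOn.congr ha'0
      · exact (continuousOn_freeLoop_eval ha hTl (continuous_apply 0) fun v hv => hv).congr ha'S)
    (by
      rw [show (Set.univ : Set I) ×ˢ Cube.boundary (Fin (n + 1)) =
        Prod.snd ⁻¹' {v | v 0 = 0 ∨ v 0 = 1} ∪ Prod.snd ⁻¹' {v | Tl v ∈ Cube.boundary (Fin n)}
        from by ext p; simpa using hbd p.2]
      refine ContinuousOn.union_of_isClosed ?_ ?_ (cl0.preimage continuous_snd)
        (clS.preimage continuous_snd)
      · exact (Continuous.continuousOn (f := fun p : I × (Fin (n + 1) → I) => K₀ (p.1, Tl p.2))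
          (by fun_prop)).congr fun p hp => hH'0 p.1 p.2 hp
      · exact (continuousOn_freeLoop_eval hH
          (φ := fun p : I × (Fin (n + 1) → I) => (θ₀ p.1, Tl p.2)) (τ := fun p => p.2 0)
          (by fun_prop) (by fun_prop) fun p hp => ⟨trivial, hp⟩).congr fun p hp => hH'S p.1 p.2 hp)
    (fun v hv => by
      rcases (hbd v).1 hv with h | h
      · rw [hH'0 0 v h, hK₀0, ha'0 v h]
      · rw [hH'S 0 v h, ha'S v h, θ₀.source, hH0 _ h]; rfl)
    (fun v hv => by
      rcases (hbd v).1 hv with h | h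
      · rw [hH'0 1 v h, hK₀1]
        rcases h with h | h
        · simp [h]
        · simp [h, (b (Tl v)).2]
      · rw [hH'S 1 v h, θ₀.target, hH1 _ h]; rfl)
  have hcons : ∀ (s : Fin n → I) (u : I), Tl (Fin.cons u s) = s := fun s u =>
    Fin.tail_cons (α := fun _ => I) u s
  have hcs : Continuous fun p : (Fin n → I) × I => (Fin.cons p.2 p.1 : Fin (n + 1) → I) :=
    (consCube n).continuous.comp continuous_swap
  have hend : ∀ (s : Fin n → I) (u : I), (u = 0 ∨ u = 1) →
      (Fin.cons u s : Fin (n + 1) → I) ∈ Cube.boundary (Fin (n + 1)) := fun s u hu =>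
    (hbd _).2 (Or.inl hu)
  -- The second solution reparametrizes a homotopy that was already reparametrized by `θ₀`, so the
  -- resulting track is `θ₀ ∘ θ`.
  refine ⟨freeLoopFamily (fun s u => c (Fin.cons u s)) (c.continuous.comp hcs) fun s => ?_,
    freeLoopFamily (fun p u => K (p.1, Fin.cons u p.2)) (K.continuous.comp
      ((continuous_fst.comp continuous_fst).prodMk
        (hcs.comp (by fun_prop : Continuous fun p : (I × (Fin n → I)) × I => (p.1.2, p.2)))))
      fun p => ?_,
    (θ.map θ₀.continuous).cast θ₀.source.symm θ₀.target.symm, fun s hs => ?_, fun s => ?_,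
    fun s => ?_, fun t s hs => ?_⟩
  · rw [hc _ (hend s 0 (Or.inl rfl)), hc _ (hend s 1 (Or.inr rfl)), ha'0 _ (Or.inl rfl),
      ha'0 _ (Or.inr rfl), hcons, hcons]
  · rw [hKS _ _ (hend p.2 0 (Or.inl rfl)), hKS _ _ (hend p.2 1 (Or.inr rfl)),
      hH'0 _ _ (Or.inl rfl), hH'0 _ _ (Or.inr rfl), hcons, hcons]
  · ext u
    have h : Tl (Fin.cons u s) ∈ Cube.boundary (Fin n) := by rwa [hcons]
    rw [freeLoopFamily_apply, hc _ ((hbd _).2 (Or.inr h)), ha'S _ h, hcons, Fin.cons_zero]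
  · ext u
    simp [hK0]
  · ext u
    rw [freeLoopFamily_apply, hK1]
    simp [hcons]
  · ext u
    have h : Tl (Fin.cons u s) ∈ Cube.boundary (Fin n) := by rwa [hcons]
    rw [freeLoopFamily_apply, hKS _ _ ((hbd _).2 (Or.inr h)), hH'S _ _ h, hcons, Fin.cons_zero]
    rfl

end

/-! ### Currying periodic maps and bijectivity on torus classes -/

section

variable {Y Z : Type u} [TopologicalSpace Y] [TopologicalSpace Z] {m : ℕ}

/-- A map on the cube `I^m` that descends to the torus `(I / ∂I)^m`. -/
def IsPeriodic {Y : Type*} {m : ℕ} (φ : (Fin m → I) → Y) : Prop :=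
  ∀ i s, φ (Function.update s i 0) = φ (Function.update s i 1)

/-- Two periodic maps are homotopic through periodic maps. -/
def PeriodicHomotopic (φ ψ : C(Fin m → I, Y)) : Prop :=
  ContinuousMap.HomotopicWith φ ψ fun χ => IsPeriodic χ

theorem periodicHomotopic_iff {φ ψ : C(Fin m → I, Y)} :
    PeriodicHomotopic φ ψ ↔ ∃ K : C(I × (Fin m → I), Y), (∀ s, K (0, s) = φ s) ∧
      (∀ s, K (1, s) = ψ s) ∧ ∀ t, IsPeriodic fun s => K (t, s) := by
  constructor
  · rintro ⟨F⟩
    exact ⟨F.toContinuousMap, F.apply_zero, F.apply_one, F.prop'⟩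
  · rintro ⟨K, h0, h1, hK⟩
    exact ⟨⟨⟨K, h0, h1⟩, hK⟩⟩

theorem IsPeriodic.comp {Y Z : Type*} {φ : (Fin m → I) → Y} (h : IsPeriodic φ) (f : Y → Z) :
    IsPeriodic fun s => f (φ s) := fun i s => congrArg f (h i s)

theorem PeriodicHomotopic.comp {φ ψ : C(Fin m → I, Y)} (h : PeriodicHomotopic φ ψ) (f : C(Y, Z)) :
    PeriodicHomotopic (f.comp φ) (f.comp ψ) := by
  rw [periodicHomotopic_iff] at h ⊢
  obtain ⟨K, h0, h1, hK⟩ := h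
  exact ⟨f.comp K, fun s => by simp [h0], fun s => by simp [h1], fun t => (hK t).comp f⟩

theorem continuous_cons_family (A : Type*) [TopologicalSpace A] :
    Continuous fun p : (A × (Fin m → I)) × I => (p.1.1, (Fin.cons p.2 p.1.2 : Fin (m + 1) → I)) :=
  (continuous_fst.comp continuous_fst).prodMk ((consCube m).continuous.comp
    (by fun_prop : Continuous fun p : (A × (Fin m → I)) × I => (p.2, p.1.2)))

/-- A family of periodic maps `I^{m+1} → Y`, as a family of maps from `I^m` to the free
loop space. -/
def curryPeriodic {A : Type*} [TopologicalSpace A] (K : C(A × (Fin (m + 1) → I), Y))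
    (hK : ∀ a, IsPeriodic fun s => K (a, s)) : C(A × (Fin m → I), FreeLoop Y) :=
  freeLoopFamily (fun p u => K (p.1, Fin.cons u p.2))
    (K.continuous.comp (continuous_cons_family A))
    fun p => by simpa using hK p.1 0 (Fin.cons 0 p.2)

theorem curryPeriodic_isPeriodic {A : Type*} [TopologicalSpace A]
    (K : C(A × (Fin (m + 1) → I), Y)) (hK : ∀ a, IsPeriodic fun s => K (a, s)) (a : A) :
    IsPeriodic fun s => curryPeriodic K hK (a, s) := fun i s => by
  ext u
  simpa [curryPeriodic, Fin.cons_update] using hK a i.succ (Fin.cons u s)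

/-- A family of maps from `I^m` to the free loop space, as a family of maps on `I^{m+1}`. -/
def uncurryPeriodic {A : Type*} [TopologicalSpace A] (K : C(A × (Fin m → I), FreeLoop Y)) :
    C(A × (Fin (m + 1) → I), Y) :=
  ⟨fun p => (K (p.1, Fin.tail p.2)).1 (p.2 0), by
    have : Continuous fun p : A × (Fin (m + 1) → I) => Fin.tail p.2 :=
      continuous_pi fun i => (continuous_apply i.succ).comp continuous_snd
    fun_prop⟩

theorem uncurryPeriodic_isPeriodic {A : Type*} [TopologicalSpace A]
    (K : C(A × (Fin m → I), FreeLoop Y)) (a : A) (hK : IsPeriodic fun s => K (a, s)) :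
    IsPeriodic fun s => uncurryPeriodic K (a, s) := fun i s => by
  refine Fin.cases ?_ (fun j => ?_) i
  · simpa [uncurryPeriodic] using! (K (a, Fin.tail s)).2
  · simpa [uncurryPeriodic, Fin.tail_update_succ] using!
      congrArg (fun γ : FreeLoop Y => γ.1 (s 0)) (hK j (Fin.tail s))

/-- The case `A = *` of `curryPeriodic`. -/
def curryPeriodicMap (φ : C(Fin (m + 1) → I, Y)) (hφ : IsPeriodic φ) : C(Fin m → I, FreeLoop Y) :=
  (curryPeriodic (A := Unit) (φ.comp ⟨Prod.snd, continuous_snd⟩) fun _ => hφ).comp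
    ⟨fun s => ((), s), by fun_prop⟩

theorem curryPeriodicMap_apply (φ : C(Fin (m + 1) → I, Y)) (hφ : IsPeriodic φ) (s : Fin m → I)
    (u : I) : (curryPeriodicMap φ hφ s).1 u = φ (Fin.cons u s) := rfl

theorem curryPeriodicMap_isPeriodic (φ : C(Fin (m + 1) → I, Y)) (hφ : IsPeriodic φ) :
    IsPeriodic (curryPeriodicMap φ hφ) :=
  curryPeriodic_isPeriodic (A := Unit) (φ.comp ⟨Prod.snd, continuous_snd⟩) (fun _ => hφ) ()

/-- On the zero-dimensional torus a homotopy is a path. The path downstairs is lifted by the lifting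
property for the interval, with the two end points prescribed and the stationary homotopy over them.
-/
theorem HasHELP.periodicHomotopic_zero [Nonempty Y] {f : C(Y, Z)} (hf : ∀ n, HasHELP f n)
    (φ₀ φ₁ : C(Fin 0 → I, Y)) (h : PeriodicHomotopic (f.comp φ₀) (f.comp φ₁)) :
    PeriodicHomotopic φ₀ φ₁ := by
  classical
  obtain ⟨K, hK0, hK1, -⟩ := periodicHomotopic_iff.1 h
  have hbd : ∀ v : Fin 1 → I, v ∈ Cube.boundary (Fin 1) ↔ v 0 = 0 ∨ v 0 = 1 := fun v => by
    simp [Cube.boundary]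
  let a : (Fin 1 → I) → Y := fun v => if v 0 = 0 then φ₀ default else φ₁ default
  have ha0 : ∀ v : Fin 1 → I, v 0 = 0 → a v = φ₀ default := fun v hv => if_pos hv
  have ha1 : ∀ v : Fin 1 → I, v 0 = 1 → a v = φ₁ default := fun v hv => if_neg (by simp [hv])
  have hab : ∀ v ∈ Cube.boundary (Fin 1), K (v 0, default) = f (a v) := fun v hv => by
    rcases (hbd v).1 hv with h | h
    · rw [ha0 v h, h, hK0]; rfl
    · rw [ha1 v h, h, hK1]; rfl
  obtain ⟨c, -, -, hc, -⟩ := hf 1 a ⟨fun v => K (v 0, default), by fun_prop⟩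
    (fun p => K (p.2 0, default)) (by
      rw [show Cube.boundary (Fin 1) = {v | v 0 = 0} ∪ {v | v 0 = 1} from Set.ext hbd]
      exact ContinuousOn.union_of_isClosed (continuousOn_const.congr ha0)
        (continuousOn_const.congr ha1) (isClosed_eq (continuous_apply 0) continuous_const)
        (isClosed_eq (continuous_apply 0) continuous_const))
    (Continuous.continuousOn (by fun_prop)) (fun v hv => hab v hv) fun v hv => rfl
  refine periodicHomotopic_iff.2 ⟨⟨fun p => c fun _ => p.1, by fun_prop⟩, fun s => ?_, fun s => ?_,
    fun t i => i.elim0⟩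
  · rw [Subsingleton.elim s default]
    exact (hc _ ((hbd _).2 (Or.inl rfl))).trans (ha0 (fun _ => 0) rfl)
  · rw [Subsingleton.elim s default]
    exact (hc _ ((hbd _).2 (Or.inr rfl))).trans (ha1 (fun _ => 1) rfl)

/-- Induction on `m` for all maps with the lifting property at once: currying one coordinate
replaces `f` by the induced map of free loop spaces, which again has that property. -/
theorem HasHELP.periodic {Y Z : Type u} [TopologicalSpace Y] [TopologicalSpace Z] [Nonempty Y]
    {f : C(Y, Z)} (hf : ∀ n, HasHELP f n) (m : ℕ) :
    (∀ ψ : C(Fin m → I, Z), IsPeriodic ψ → ∃ φ : C(Fin m → I, Y), IsPeriodic φ ∧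
      PeriodicHomotopic (f.comp φ) ψ) ∧
    ∀ φ₀ φ₁ : C(Fin m → I, Y), IsPeriodic φ₀ → IsPeriodic φ₁ →
      PeriodicHomotopic (f.comp φ₀) (f.comp φ₁) → PeriodicHomotopic φ₀ φ₁ := by
  induction m generalizing Y Z with
  | zero =>
    refine ⟨fun ψ _ => ?_, fun φ₀ φ₁ _ _ h => HasHELP.periodicHomotopic_zero hf φ₀ φ₁ h⟩
    have hempty : Cube.boundary (Fin 0) = ∅ := by
      ext s; simp [Cube.boundary]
    obtain ⟨c, K, -, -, h0, h1, -⟩ := hf 0 (fun _ => Classical.arbitrary Y) ψ (fun p => ψ p.2)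
      continuousOn_const (by simp [hempty]) (by simp [hempty]) (by simp [hempty])
    exact ⟨c, fun i => i.elim0, periodicHomotopic_iff.2 ⟨K, h0, h1, fun t i => i.elim0⟩⟩
  | succ m ih =>
    have : Nonempty (FreeLoop Y) := ⟨⟨ContinuousMap.const _ (Classical.arbitrary Y), rfl⟩⟩
    obtain ⟨ih₁, ih₂⟩ := ih (HasHELP.freeLoop hf)
    constructor
    · intro ψ hψ
      obtain ⟨φ', hφ', h⟩ := ih₁ (curryPeriodicMap ψ hψ) (curryPeriodicMap_isPeriodic ψ hψ)
      obtain ⟨K, hK0, hK1, hK⟩ := periodicHomotopic_iff.1 h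
      let φ : C(Fin (m + 1) → I, Y) :=
        (uncurryPeriodic (A := Unit) (φ'.comp ⟨Prod.snd, continuous_snd⟩)).comp
          ⟨fun s => ((), s), by fun_prop⟩
      refine ⟨φ, uncurryPeriodic_isPeriodic (A := Unit) _ () hφ',
        periodicHomotopic_iff.2 ⟨uncurryPeriodic K, fun v => ?_, fun v => ?_,
          fun t => uncurryPeriodic_isPeriodic K t (hK t)⟩⟩
      · exact congrArg (fun γ : FreeLoop Z => γ.1 (v 0)) (hK0 (Fin.tail v))
      · refine (congrArg (fun γ : FreeLoop Z => γ.1 (v 0)) (hK1 (Fin.tail v))).trans ?_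
        rw [curryPeriodicMap_apply, Fin.cons_self_tail]
    · intro φ₀ φ₁ h₀ h₁ h
      obtain ⟨K, hK0, hK1, hK⟩ := periodicHomotopic_iff.1 h
      obtain ⟨L, hL0, hL1, hL⟩ := periodicHomotopic_iff.1 (ih₂ (curryPeriodicMap φ₀ h₀)
        (curryPeriodicMap φ₁ h₁) (curryPeriodicMap_isPeriodic φ₀ h₀)
        (curryPeriodicMap_isPeriodic φ₁ h₁) (periodicHomotopic_iff.2
          ⟨curryPeriodic K hK, fun s => Subtype.ext (ContinuousMap.ext fun u => hK0 _),
            fun s => Subtype.ext (ContinuousMap.ext fun u => hK1 _),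
            curryPeriodic_isPeriodic K hK⟩))
      refine periodicHomotopic_iff.2 ⟨uncurryPeriodic L, fun v => ?_, fun v => ?_,
        fun t => uncurryPeriodic_isPeriodic L t (hL t)⟩
      · refine (congrArg (fun γ : FreeLoop Y => γ.1 (v 0)) (hL0 (Fin.tail v))).trans ?_
        rw [curryPeriodicMap_apply, Fin.cons_self_tail]
      · refine (congrArg (fun γ : FreeLoop Y => γ.1 (v 0)) (hL1 (Fin.tail v))).trans ?_
        rw [curryPeriodicMap_apply, Fin.cons_self_tail]

end

end NilHtpy

namespace NilHtpy

/-! ### Homotopy classes of maps from a torus -/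

open scoped commutatorElement

noncomputable section

section

variable {Y Z : Type u} [TopologicalSpace Y] [TopologicalSpace Z] {m : ℕ}

theorem PeriodicHomotopic.refl {φ : C(Fin m → I, Y)} (h : IsPeriodic φ) : PeriodicHomotopic φ φ :=
  ContinuousMap.HomotopicWith.refl φ h

/-- Homotopy through periodic maps, as an equivalence relation. -/
instance periodicSetoid (m : ℕ) (Y : Type u) [TopologicalSpace Y] :
    Setoid {φ : C(Fin m → I, Y) // IsPeriodic φ} where
  r φ ψ := PeriodicHomotopic φ.1 ψ.1
  iseqv := ⟨fun φ => PeriodicHomotopic.refl φ.2, fun h => ContinuousMap.HomotopicWith.symm h,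
    fun h h' => ContinuousMap.HomotopicWith.trans h h'⟩

/-- The set of free homotopy classes of maps from the `m`-dimensional torus to `Y`. -/
def TorusClass (m : ℕ) (Y : Type u) [TopologicalSpace Y] : Type u :=
  Quotient (periodicSetoid m Y)

/-- The class of a periodic map. -/
def TorusClass.mk (φ : C(Fin m → I, Y)) (h : IsPeriodic φ) : TorusClass m Y :=
  Quotient.mk (periodicSetoid m Y) ⟨φ, h⟩

theorem TorusClass.mk_eq_iff {φ ψ : C(Fin m → I, Y)} (h : IsPeriodic φ) (h' : IsPeriodic ψ) :
    TorusClass.mk φ h = TorusClass.mk ψ h' ↔ PeriodicHomotopic φ ψ :=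
  Quotient.eq (r := periodicSetoid m Y)

theorem TorusClass.ind {p : TorusClass m Y → Prop} (h : ∀ φ hφ, p (TorusClass.mk φ hφ)) (a) :
    p a := Quotient.inductionOn a fun φ => h φ.1 φ.2

/-- The map of homotopy classes induced by a continuous map. -/
def TorusClass.map (m : ℕ) (f : C(Y, Z)) : TorusClass m Y → TorusClass m Z :=
  Quotient.map (fun φ => ⟨f.comp φ.1, φ.2.comp f⟩) fun _ _ h => PeriodicHomotopic.comp h f

@[simp]
theorem TorusClass.map_mk (f : C(Y, Z)) (φ : C(Fin m → I, Y)) (h : IsPeriodic φ) :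
    TorusClass.map m f (TorusClass.mk φ h) = TorusClass.mk (f.comp φ) (h.comp f) := rfl

/-- This is what lets torus classes be evaluated on objects of the homotopy category, in particular
on the values of `N`. -/
theorem IsWeakEquiv.bijective_torusClassMap [Nonempty Y] {f : C(Y, Z)} (hf : IsWeakEquiv f)
    (m : ℕ) : Function.Bijective (TorusClass.map m f) := by
  obtain ⟨h₁, h₂⟩ := HasHELP.periodic hf.hasHELP m
  constructor
  · intro a b
    induction a using TorusClass.ind with
    | h φ hφ =>
      induction b using TorusClass.ind with
      | h ψ hψ =>
        rw [TorusClass.map_mk, TorusClass.map_mk, TorusClass.mk_eq_iff, TorusClass.mk_eq_iff]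
        exact h₂ φ ψ hφ hψ
  · intro a
    induction a using TorusClass.ind with
    | h ψ hψ =>
      obtain ⟨φ, hφ, h⟩ := h₁ ψ hψ
      exact ⟨TorusClass.mk φ hφ, by rwa [TorusClass.map_mk, TorusClass.mk_eq_iff]⟩

end

/-! ### The group structure on homotopy classes of maps to a loop space -/

section

variable {X : Type u} [TopologicalSpace X] {x : X} {m : ℕ}

/-- Convex combination in the unit interval. -/
def lerp (t a b : I) : I :=
  ⟨(1 - (t : ℝ)) * a + t * b, by
    have := (convex_Icc (0 : ℝ) 1) a.2 b.2 (sub_nonneg.2 t.2.2) t.2.1 (by ring)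
    simpa [smul_eq_mul] using this⟩

@[simp] theorem lerp_zero (a b : I) : lerp 0 a b = a := Subtype.ext (by simp [lerp])

@[simp] theorem lerp_one (a b : I) : lerp 1 a b = b := Subtype.ext (by simp [lerp])

@[simp] theorem lerp_self (t a : I) : lerp t a a = a := Subtype.ext (by simp [lerp]; ring)

theorem continuous_lerp : Continuous fun p : I × I × I => lerp p.1 p.2.1 p.2.2 :=
  Continuous.subtype_mk (by fun_prop) _

/-- Two reparametrizations of a family of loops that agree at the ends are homotopic. -/
theorem periodicHomotopic_reparam {φ ψ : C(Fin m → I, LoopSpace X x)}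
    (G : C(Fin m → I, LoopSpace X x)) (hG : IsPeriodic G) {a b : I} (θ₀ θ₁ : Path a b)
    (ha : ∀ s, G s a = x) (hb : ∀ s, G s b = x) (hφ : ∀ s u, φ s u = G s (θ₀ u))
    (hψ : ∀ s u, ψ s u = G s (θ₁ u)) : PeriodicHomotopic φ ψ := by
  -- Linear interpolation between `θ₀` and `θ₁` keeps the common ends `a` and `b`, where `G` takes
  -- the value `x`, so every stage consists of loops at `x`.
  let K : I × (Fin m → I) → LoopSpace X x := fun p =>
    { toFun := fun u => G p.2 (lerp p.1 (θ₀ u) (θ₁ u))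
      continuous_toFun := by
        have := continuous_lerp.comp
          (by fun_prop : Continuous fun u : I => (p.1, θ₀ u, θ₁ u))
        exact (G p.2).continuous.comp this
      source' := by simp [ha]
      target' := by simp [hb] }
  have hK : Continuous K := by
    refine Path.continuous_uncurry_iff.1 ?_
    have h₁ : Continuous fun q : (I × (Fin m → I)) × I => lerp q.1.1 (θ₀ q.2) (θ₁ q.2) :=
      continuous_lerp.comp
        (by fun_prop : Continuous fun q : (I × (Fin m → I)) × I => (q.1.1, θ₀ q.2, θ₁ q.2))
    exact (Path.continuous_uncurry_iff.2 G.continuous).comp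
      ((continuous_snd.comp continuous_fst).prodMk h₁)
  refine periodicHomotopic_iff.2 ⟨⟨K, hK⟩, fun s => ?_, fun s => ?_, fun t i s => ?_⟩
  · ext u; simp [K, hφ]
  · ext u; simp [K, hψ]
  · ext u
    simp [K, hG i s]

/-- The pointwise concatenation of two families of loops. -/
def loopMul (φ ψ : C(Fin m → I, LoopSpace X x)) : C(Fin m → I, LoopSpace X x) :=
  ⟨fun s => (φ s).trans (ψ s), φ.continuous.path_trans ψ.continuous⟩

/-- The pointwise inverse of a family of loops. -/
def loopInv (φ : C(Fin m → I, LoopSpace X x)) : C(Fin m → I, LoopSpace X x) :=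
  ⟨fun s => (φ s).symm, Path.continuous_symm.comp φ.continuous⟩

theorem IsPeriodic.loopMul {φ ψ : C(Fin m → I, LoopSpace X x)} (hφ : IsPeriodic φ)
    (hψ : IsPeriodic ψ) : IsPeriodic (loopMul φ ψ) := fun i s => by
  simp [NilHtpy.loopMul, hφ i s, hψ i s]

theorem IsPeriodic.loopInv {φ : C(Fin m → I, LoopSpace X x)} (hφ : IsPeriodic φ) :
    IsPeriodic (loopInv φ) := fun i s => by
  simp [NilHtpy.loopInv, hφ i s]

theorem isPeriodic_const (m : ℕ) {Y : Type*} (y : Y) : IsPeriodic fun _ : Fin m → I => y :=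
  fun _ _ => rfl

theorem PeriodicHomotopic.loopMul {φ φ' ψ ψ' : C(Fin m → I, LoopSpace X x)}
    (h : PeriodicHomotopic φ φ') (h' : PeriodicHomotopic ψ ψ') :
    PeriodicHomotopic (loopMul φ ψ) (loopMul φ' ψ') := by
  rw [periodicHomotopic_iff] at h h' ⊢
  obtain ⟨K, h0, h1, hK⟩ := h
  obtain ⟨K', h0', h1', hK'⟩ := h'
  refine ⟨⟨fun p => (K p).trans (K' p), K.continuous.path_trans K'.continuous⟩, fun s => ?_,
    fun s => ?_, fun t i s => ?_⟩
  · simp [h0, h0', NilHtpy.loopMul]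
  · simp [h1, h1', NilHtpy.loopMul]
  · have e := hK t i s
    have e' := hK' t i s
    simp only at e e'
    simp [e, e']

theorem PeriodicHomotopic.loopInv {φ φ' : C(Fin m → I, LoopSpace X x)}
    (h : PeriodicHomotopic φ φ') : PeriodicHomotopic (loopInv φ) (loopInv φ') := by
  rw [periodicHomotopic_iff] at h ⊢
  obtain ⟨K, h0, h1, hK⟩ := h
  refine ⟨⟨fun p => (K p).symm, Path.continuous_symm.comp K.continuous⟩, fun s => ?_,
    fun s => ?_, fun t i s => ?_⟩
  · simp [h0, NilHtpy.loopInv]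
  · simp [h1, NilHtpy.loopInv]
  · have e := hK t i s
    simp only at e
    simp [e]

namespace TorusClass

instance : Mul (TorusClass m (LoopSpace X x)) where
  mul := Quotient.map₂ (fun φ ψ => ⟨loopMul φ.1 ψ.1, φ.2.loopMul ψ.2⟩)
    fun _ _ h _ _ h' => PeriodicHomotopic.loopMul h h'

instance : Inv (TorusClass m (LoopSpace X x)) where
  inv := Quotient.map (fun φ => ⟨loopInv φ.1, φ.2.loopInv⟩) fun _ _ h => PeriodicHomotopic.loopInv h

instance : One (TorusClass m (LoopSpace X x)) where
  one := mk (ContinuousMap.const _ (Path.refl x)) (isPeriodic_const m _)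

theorem mk_mul (φ ψ : C(Fin m → I, LoopSpace X x)) (hφ : IsPeriodic φ) (hψ : IsPeriodic ψ) :
    mk φ hφ * mk ψ hψ = mk (loopMul φ ψ) (hφ.loopMul hψ) := rfl

/-- The group structure on the homotopy classes of maps from a torus to a loop space, induced by
the concatenation of loops. -/
instance : Group (TorusClass m (LoopSpace X x)) := by
  refine Group.ofRightAxioms (fun a b c => ?_) (fun a => ?_) fun a => ?_
  · induction a using TorusClass.ind with | h φ hφ
    induction b using TorusClass.ind with | h ψ hψ
    induction c using TorusClass.ind with | h χ hχ
    simp only [mk_mul, mk_eq_iff]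
    refine periodicHomotopic_reparam (loopMul φ (loopMul ψ χ)) (hφ.loopMul (hψ.loopMul hχ))
      ⟨⟨fun t => ⟨Path.Homotopy.transAssocReparamAux t,
        Path.Homotopy.transAssocReparamAux_mem_I t⟩,
        Path.Homotopy.continuous_transAssocReparamAux.subtype_mk _⟩,
        Subtype.ext Path.Homotopy.transAssocReparamAux_zero,
        Subtype.ext Path.Homotopy.transAssocReparamAux_one⟩ idPath (fun s => Path.source _)
      (fun s => Path.target _) (fun s u => ?_) fun s u => rfl
    exact congrArg (fun p : Path x x => p u)
      (Path.Homotopy.trans_assoc_reparam (φ s) (ψ s) (χ s))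
  · induction a using TorusClass.ind with | h φ hφ
    refine (mk_eq_iff (hφ.loopMul (isPeriodic_const m _)) hφ).2 ?_
    refine periodicHomotopic_reparam φ hφ
      ⟨⟨fun t => ⟨Path.Homotopy.transReflReparamAux t,
        Path.Homotopy.transReflReparamAux_mem_I t⟩,
        Path.Homotopy.continuous_transReflReparamAux.subtype_mk _⟩,
        Subtype.ext Path.Homotopy.transReflReparamAux_zero,
        Subtype.ext Path.Homotopy.transReflReparamAux_one⟩ idPath (fun s => Path.source _)
      (fun s => Path.target _) (fun s u => ?_) fun s u => rfl
    exact congrArg (fun p : Path x x => p u) (Path.Homotopy.trans_refl_reparam (φ s))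
  · induction a using TorusClass.ind with | h φ hφ
    refine (mk_eq_iff (hφ.loopMul hφ.loopInv) (isPeriodic_const m _)).2 ?_
    -- A loop followed by its inverse is the loop reparametrized by the path `0 → 1 → 0`, which
    -- contracts to the constant path at `0`.
    refine periodicHomotopic_reparam φ hφ (idPath.trans idPath.symm) (Path.refl 0)
      (fun s => Path.source _) (fun s => Path.source _) (fun s u => ?_) fun s u => ?_
    · change ((φ s).trans (φ s).symm) u = _
      rw [Path.trans_apply, Path.trans_apply]
      split_ifs <;> simp
    · simp

theorem mk_commutator (φ ψ : C(Fin m → I, LoopSpace X x)) (hφ : IsPeriodic φ)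
    (hψ : IsPeriodic ψ) : ⁅mk φ hφ, mk ψ hψ⁆ =
      mk (loopMul (loopMul (loopMul φ ψ) (loopInv φ)) (loopInv ψ))
        (((hφ.loopMul hψ).loopMul hφ.loopInv).loopMul hψ.loopInv) := rfl

end TorusClass

theorem IsPeriodic.comp_injective {Y : Type*} {a : ℕ} {φ : (Fin a → I) → Y} (h : IsPeriodic φ)
    {e : Fin a → Fin m} (he : Function.Injective e) : IsPeriodic fun s => φ (s ∘ e) := by
  intro i s
  by_cases hi : i ∈ Set.range e
  · obtain ⟨j, rfl⟩ := hi
    simp only [Function.update_comp_eq_of_injective _ he]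
    exact h j _
  · simp only [Function.update_comp_eq_of_notMem_range _ _ hi]

/-- The homomorphism induced by the projection of tori that selects the coordinates `e`. -/
def TorusClass.pullback {a : ℕ} (e : Fin a → Fin m) (he : Function.Injective e) :
    TorusClass a (LoopSpace X x) →* TorusClass m (LoopSpace X x) :=
  MonoidHom.mk' (Quotient.map (fun φ => ⟨φ.1.comp ⟨fun s => s ∘ e, by fun_prop⟩,
    φ.2.comp_injective he⟩) (by
      intro φ ψ h
      obtain ⟨K, h0, h1, hK⟩ := periodicHomotopic_iff.1 h
      exact periodicHomotopic_iff.2 ⟨K.comp ⟨fun p => (p.1, p.2 ∘ e), by fun_prop⟩,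
        fun s => h0 _, fun s => h1 _, fun t => (hK t).comp_injective he⟩))
    (by
      intro a b
      induction a using TorusClass.ind
      induction b using TorusClass.ind
      rfl)

theorem TorusClass.pullback_mk {a : ℕ} (e : Fin a → Fin m) (he : Function.Injective e)
    (φ : C(Fin a → I, LoopSpace X x)) (h : IsPeriodic φ) :
    TorusClass.pullback e he (TorusClass.mk φ h) =
      TorusClass.mk (φ.comp ⟨fun s => s ∘ e, by fun_prop⟩) (h.comp_injective he) := rfl

/-! ### Iterated commutators and iterated Whitehead products -/

/-- `k`-fold iterated commutators, with an arbitrary bracketing, in a group. -/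
inductive IsIteratedCommutator {G : Type*} [Group G] : ℕ → G → Prop
  | single (g : G) : IsIteratedCommutator 1 g
  | bracket {j k : ℕ} {g h : G} (hg : IsIteratedCommutator j g) (hh : IsIteratedCommutator k h) :
      IsIteratedCommutator (j + k) ⁅g, h⁆

theorem IsIteratedCommutator.map {G H : Type*} [Group G] [Group H] (f : G →* H) {k : ℕ} {g : G}
    (h : IsIteratedCommutator k g) : IsIteratedCommutator k (f g) := by
  induction h with
  | single g => exact .single _
  | bracket _ _ ih ih' => rw [map_commutatorElement]; exact .bracket ih ih'

theorem update_mem_boundary {ι : Type*} [DecidableEq ι] (s : ι → I) (i : ι) {t : I}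
    (ht : t = 0 ∨ t = 1) : Function.update s i t ∈ Cube.boundary ι :=
  ⟨i, by simpa using ht⟩

theorem isPeriodic_genLoop {Y : Type u} [TopologicalSpace Y] {y : Y} (f : Ω^ (Fin m) Y y) :
    IsPeriodic f.1 := fun i s => by
  rw [f.2 _ (update_mem_boundary s i (Or.inl rfl)), f.2 _ (update_mem_boundary s i (Or.inr rfl))]

/-- The class of the composite of the adjoint `S^m → ΩX` of a map `S^{m+1} → X` with the quotient
map from the `m`-dimensional torus to `S^m`. -/
def adjointClass (f : Ω^ (Fin (m + 1)) X x) : TorusClass m (LoopSpace X x) :=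
  TorusClass.mk (adjoint f).1 (isPeriodic_genLoop _)

theorem continuous_snoc {A : Type*} [TopologicalSpace A] {g : A → Fin m → I} {t : A → I}
    (hg : Continuous g) (ht : Continuous t) :
    Continuous fun a => (Fin.snoc (α := fun _ => I) (g a) (t a) : Fin (m + 1) → I) := by
  fun_prop

theorem adjointClass_eq_of_homotopic {f g : Ω^ (Fin (m + 1)) X x}
    (h : GenLoop.Homotopic f g) : adjointClass f = adjointClass g := by
  obtain ⟨F⟩ := h
  have hF : ∀ t, ∀ v ∈ Cube.boundary (Fin (m + 1)), F (t, v) = x := fun t v hv =>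
    (F.eq_fst t hv).trans (f.2 v hv)
  have hlast : ∀ (s : Fin m → I) {u : I}, (u = 0 ∨ u = 1) →
      (Fin.snoc (α := fun _ => I) s u : Fin (m + 1) → I) ∈ Cube.boundary (Fin (m + 1)) :=
    fun s u hu => ⟨Fin.last m, by simpa using hu⟩
  refine (TorusClass.mk_eq_iff _ _).2 (periodicHomotopic_iff.2 ⟨⟨fun p =>
    { toFun := fun u => F (p.1, Fin.snoc (α := fun _ => I) p.2 u)
      continuous_toFun := F.continuous.comp
        (continuous_const.prodMk (continuous_snoc continuous_const continuous_id))
      source' := hF _ _ (hlast _ (Or.inl rfl))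
      target' := hF _ _ (hlast _ (Or.inr rfl)) }, ?_⟩, fun s => ?_, fun s => ?_, fun t i s => ?_⟩)
  · refine Path.continuous_uncurry_iff.1 (F.continuous.comp ?_)
    exact (continuous_fst.comp continuous_fst).prodMk
      (continuous_snoc (continuous_snd.comp continuous_fst) continuous_snd)
  · ext u; exact F.apply_zero _
  · ext u; exact F.apply_one _
  · ext u
    refine (hF _ _ ⟨i.castSucc, Or.inl ?_⟩).trans (hF _ _ ⟨i.castSucc, Or.inr ?_⟩).symm <;> simp

/-- Each coordinate belongs to exactly one of the two blocks. Its two opposite faces lie in the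
boundary of that block, whose points `φ` does not distinguish. -/
theorem IsPointedMapOfProdSpheres.isPeriodic {Y : Type u} [TopologicalSpace Y] {y : Y} {a b : ℕ}
    {φ : C((I^ (Fin a)) × (I^ (Fin b)), Y)} (h : IsPointedMapOfProdSpheres y φ) :
    IsPeriodic fun s : Fin (a + b) → I => φ (s ∘ Fin.castAdd b, s ∘ Fin.natAdd a) := by
  have hl := Fin.castAdd_injective a b
  have hr := Fin.natAdd_injective b a
  intro i s
  refine Fin.addCases (fun j => ?_) (fun j => ?_) i
  · have hj : Fin.castAdd b j ∉ Set.range (Fin.natAdd a : Fin b → Fin (a + b)) := by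
      rintro ⟨k, hk⟩
      have := congrArg Fin.val hk
      simp at this
      omega
    simp only [Function.update_comp_eq_of_injective _ hl,
      Function.update_comp_eq_of_notMem_range _ _ hj]
    exact h.1 _ (update_mem_boundary _ _ (Or.inl rfl)) _ (update_mem_boundary _ _ (Or.inr rfl)) _
  · have hj : Fin.natAdd a j ∉ Set.range (Fin.castAdd b : Fin a → Fin (a + b)) := by
      rintro ⟨k, hk⟩
      have := congrArg Fin.val hk
      simp at this
      omega
    simp only [Function.update_comp_eq_of_injective _ hr,
      Function.update_comp_eq_of_notMem_range _ _ hj]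
    exact h.2.1 _ (update_mem_boundary _ _ (Or.inl rfl)) _ (update_mem_boundary _ _ (Or.inr rfl)) _

/-- The homotopy through pointed maps on `S^a × S^b` is pulled back along `T^{a+b} → S^a × S^b`.
There the commutator map becomes the pointwise commutator of the two families, each read off its own
block of coordinates. -/
theorem IsSamelsonProduct.mk_eq_commutator {a b : ℕ}
    {f : Ω^ (Fin a) (LoopSpace X x) (Path.refl x)} {g : Ω^ (Fin b) (LoopSpace X x) (Path.refl x)}
    {h : Ω^ (Fin (a + b)) (LoopSpace X x) (Path.refl x)} (H : IsSamelsonProduct f g h) :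
    TorusClass.mk h.1 (isPeriodic_genLoop h) =
      ⁅TorusClass.pullback (Fin.castAdd b) (Fin.castAdd_injective a b)
          (TorusClass.mk f.1 (isPeriodic_genLoop f)),
        TorusClass.pullback (Fin.natAdd a) (Fin.natAdd_injective b a)
          (TorusClass.mk g.1 (isPeriodic_genLoop g))⁆ := by
  obtain ⟨F⟩ := H
  rw [TorusClass.pullback_mk, TorusClass.pullback_mk, TorusClass.mk_commutator,
    TorusClass.mk_eq_iff, periodicHomotopic_iff]
  refine ⟨⟨fun p => F (p.1, (p.2 ∘ Fin.castAdd b, p.2 ∘ Fin.natAdd a)), by fun_prop⟩,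
    fun s => ?_, fun s => ?_, fun t => (F.prop' t).isPeriodic⟩
  · refine (F.apply_zero _).trans (congrArg h.1 ?_)
    exact Fin.append_castAdd_natAdd
  · exact F.apply_one _

/-- Pulling back to a larger torus is a homomorphism, so commutators of lower weight persist. Every
representative is allowed, since each Whitehead product comes with representatives of its own. -/
theorem IsIteratedWhiteheadProduct.isIteratedCommutator {k m : ℕ} {γ : π_ (m + 1) X x}
    (h : IsIteratedWhiteheadProduct k m γ) :
    ∀ f : Ω^ (Fin (m + 1)) X x, (⟦f⟧ : π_ (m + 1) X x) = γ →
      IsIteratedCommutator k (adjointClass f) := by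
  induction h with
  | single α => exact fun f _ => .single _
  | bracket _ _ hγ ih ih' =>
    obtain ⟨f, g, h, hf, hg, hh, H⟩ := hγ
    intro f' hf'
    rw [adjointClass_eq_of_homotopic (Quotient.exact (hf'.trans hh.symm))]
    change IsIteratedCommutator _ (TorusClass.mk _ _)
    rw [H.mk_eq_commutator]
    exact .bracket ((ih f hf).map _) ((ih' g hg).map _)

end

end

end NilHtpy

open scoped commutatorElement

namespace NilHtpy

/-! ### Maps on the torus that come from a sphere -/

noncomputable section

section

variable {X : Type u} {x : X} {m : ℕ}

/-- A map `I^m × I → X` that sends the ends `I^m × ∂I` to `x`, is periodic in the coordinates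
in `J`, and sends the faces in the directions of the remaining coordinates to `x`. -/
def IsPartlyPeriodic (x : X) (J : Finset (Fin m)) (ψ : (Fin m → I) × I → X) : Prop :=
  (∀ s u, (u = 0 ∨ u = 1) → ψ (s, u) = x) ∧
  (∀ i ∈ J, ∀ s u, ψ (Function.update s i 0, u) = ψ (Function.update s i 1, u)) ∧
  ∀ i ∉ J, ∀ s u, (s i = 0 ∨ s i = 1) → ψ (s, u) = x

/-- Projection of the real line to the unit interval. -/
abbrev clamp (r : ℝ) : I := Set.projIcc 0 1 zero_le_one r

theorem clamp_of_nonpos {r : ℝ} (h : r ≤ 0) : clamp r = 0 := Set.projIcc_of_le_left _ h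

theorem clamp_of_one_le {r : ℝ} (h : 1 ≤ r) : clamp r = 1 := Set.projIcc_of_right_le _ h

/-- A map of the torus family `ψ` is changed into one that sends the two faces in the direction
`j` to the base point: the loops `ψ(s, -)` are multiplied by the inverses of the loops at `s_j = 0`,
and the resulting null homotopic loops at the two faces are contracted in a collar. -/
def faceRetraction (j : Fin m) (ψ : (Fin m → I) × I → X) (p : (Fin m → I) × I) : X :=
  if (p.2 : ℝ) ≤ 1 / 2 then
    ψ (Function.update p.1 j (clamp (3 * p.1 j - 1)),
      min (clamp (2 * p.2)) (clamp (min (3 * p.1 j) (3 - 3 * p.1 j))))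
  else
    ψ (Function.update p.1 j 0,
      min (clamp (2 - 2 * p.2)) (clamp (min (3 * p.1 j) (3 - 3 * p.1 j))))

/-- These are the cases in which the two halves of `faceRetraction` are seen to agree at `u = 1/2`:
in the collars the rescaled coordinate is an end, and between them the cutoff is `1`. -/
theorem collar_trichotomy (t : I) :
    clamp (3 * (t : ℝ) - 1) = 0 ∨ clamp (3 * (t : ℝ) - 1) = 1 ∨
      clamp (min (3 * (t : ℝ)) (3 - 3 * t)) = 1 := by
  by_cases h₁ : 3 * (t : ℝ) - 1 ≤ 0
  · exact Or.inl (clamp_of_nonpos h₁)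
  by_cases h₂ : 1 ≤ 3 * (t : ℝ) - 1
  · exact Or.inr (Or.inl (clamp_of_one_le h₂))
  · refine Or.inr (Or.inr (clamp_of_one_le (le_min ?_ ?_))) <;> linarith

theorem collar_end {t : I} (h : t = 0 ∨ t = 1) : clamp (min (3 * (t : ℝ)) (3 - 3 * t)) = 0 := by
  refine clamp_of_nonpos ?_
  rcases h with rfl | rfl
  · exact min_le_of_left_le (by simp)
  · exact min_le_of_right_le (by simp)

/-- On the faces in direction `j` the cutoff vanishes, so `ψ` is evaluated at loop time `0` and
gives `x`. Only coordinate `j` is altered, so the conditions in the other directions are inherited.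
-/
theorem IsPartlyPeriodic.faceRetraction {J : Finset (Fin m)} {j : Fin m} (hj : j ∉ J)
    {ψ : (Fin m → I) × I → X} (h : IsPartlyPeriodic x (insert j J) ψ) :
    IsPartlyPeriodic x J (faceRetraction j ψ) := by
  obtain ⟨h₁, h₂, h₃⟩ := h
  refine ⟨fun s u hu => ?_, fun i hi s u => ?_, fun i hi s u hs => ?_⟩
  · rcases hu with rfl | rfl
    · have : clamp (2 * ((0 : I) : ℝ)) = 0 := clamp_of_nonpos (by simp)
      simp only [NilHtpy.faceRetraction]
      rw [if_pos (by simp), this]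
      exact h₁ _ _ (Or.inl (min_eq_left bot_le))
    · have : clamp (2 - 2 * ((1 : I) : ℝ)) = 0 := clamp_of_nonpos (by simp)
      simp only [NilHtpy.faceRetraction]
      rw [if_neg (by norm_num), this]
      exact h₁ _ _ (Or.inl (min_eq_left bot_le))
  · have hij : j ≠ i := fun e => hj (e ▸ hi)
    simp only [NilHtpy.faceRetraction, Function.update_of_ne hij,
      Function.update_comm hij.symm, h₂ i (Finset.mem_insert_of_mem hi)]
  · by_cases hij : i = j
    · subst hij
      simp only [NilHtpy.faceRetraction, collar_end hs]
      split_ifs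
      · exact h₁ _ _ (Or.inl (min_eq_right bot_le))
      · exact h₁ _ _ (Or.inl (min_eq_right bot_le))
    · have hi' : i ∉ insert j J := by simp [hij, hi]
      simp only [NilHtpy.faceRetraction]
      split_ifs
      · exact h₃ i hi' _ _ (by rwa [Function.update_of_ne hij])
      · exact h₃ i hi' _ _ (by rwa [Function.update_of_ne hij])

theorem IsPartlyPeriodic.insert {J : Finset (Fin m)} (j : Fin m)
    {ψ : (Fin m → I) × I → X} (h : IsPartlyPeriodic x J ψ) :
    IsPartlyPeriodic x (insert j J) ψ := by
  refine ⟨h.1, fun i hi s u => ?_, fun i hi => h.2.2 i fun hi' => hi (Finset.mem_insert_of_mem hi')⟩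
  by_cases hiJ : i ∈ J
  · exact h.2.1 i hiJ s u
  · rw [h.2.2 i hiJ _ _ (by simp), h.2.2 i hiJ _ _ (by simp)]

/-- When `ψ` is already `x` on the faces in direction `j`, the inverse factor is constant and the
collars are constant too. Only a reparametrization of `ψ` remains. -/
theorem faceRetraction_eq {J : Finset (Fin m)} {j : Fin m} (hj : j ∉ J)
    {ψ : (Fin m → I) × I → X} (h : IsPartlyPeriodic x J ψ) (s : Fin m → I) (u : I) :
    faceRetraction j ψ (s, u) =
      ψ (Function.update s j (clamp (3 * s j - 1)), clamp (2 * u)) := by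
  simp only [faceRetraction]
  split_ifs with hu
  · rcases collar_trichotomy (s j) with h' | h' | h'
    · rw [h.2.2 j hj _ _ (by simp [h']), h.2.2 j hj _ _ (by simp [h'])]
    · rw [h.2.2 j hj _ _ (by simp [h']), h.2.2 j hj _ _ (by simp [h'])]
    · rw [h', min_eq_left unitInterval.le_one']
  · rw [h.2.2 j hj _ _ (by simp), h.1 _ _ (Or.inr (clamp_of_one_le (by linarith)))]

variable [TopologicalSpace X]

theorem continuous_faceRetraction {A : Type*} [TopologicalSpace A] {J : Finset (Fin m)}
    (j : Fin m) (K : C(A × ((Fin m → I) × I), X))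
    (hK : ∀ a, IsPartlyPeriodic x (insert j J) fun p => K (a, p)) :
    Continuous fun p : A × ((Fin m → I) × I) => faceRetraction j (fun q => K (p.1, q)) p.2 := by
  have hc : Continuous (clamp : ℝ → I) := continuous_projIcc
  unfold faceRetraction
  refine Continuous.if_le ?_ ?_ (by fun_prop) continuous_const ?_
  · fun_prop
  · fun_prop
  · rintro ⟨a, s, u⟩ hu
    simp only at hu ⊢
    have e₁ : clamp (2 * (1 / 2)) = 1 := clamp_of_one_le (by norm_num)
    have e₂ : clamp (2 - 2 * (1 / 2)) = 1 := clamp_of_one_le (by norm_num)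
    rw [hu, e₁, e₂, min_eq_right unitInterval.le_one']
    rcases collar_trichotomy (s j) with h | h | h
    · rw [h]
    · rw [h]
      exact ((hK a).2.1 j (Finset.mem_insert_self _ _) s _).symm
    · rw [h]
      exact ((hK a).1 _ _ (Or.inr rfl)).trans ((hK a).1 _ _ (Or.inr rfl)).symm

/-- The reparametrization in `faceRetraction_eq` fixes the ends in both variables, so linear
interpolation to the identity respects all the boundary conditions. -/
theorem homotopicWith_faceRetraction {J : Finset (Fin m)} {j : Fin m} (hj : j ∉ J)
    (ψ φ : C((Fin m → I) × I, X)) (h : IsPartlyPeriodic x J ψ)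
    (hφ : ∀ p, φ p = faceRetraction j ψ p) :
    ContinuousMap.HomotopicWith ψ φ fun χ => IsPartlyPeriodic x J χ := by
  have hc : Continuous (clamp : ℝ → I) := continuous_projIcc
  have hl := continuous_lerp
  have c₁ : Continuous fun p : I × ((Fin m → I) × I) =>
      lerp p.1 (p.2.1 j) (clamp (3 * p.2.1 j - 1)) :=
    hl.comp (by fun_prop : Continuous fun p : I × ((Fin m → I) × I) =>
      (p.1, p.2.1 j, clamp (3 * p.2.1 j - 1)))
  have c₂ : Continuous fun p : I × ((Fin m → I) × I) =>
      lerp p.1 p.2.2 (clamp (2 * p.2.2)) :=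
    hl.comp (by fun_prop : Continuous fun p : I × ((Fin m → I) × I) =>
      (p.1, p.2.2, clamp (2 * p.2.2)))
  have hz : clamp (3 * ((0 : I) : ℝ) - 1) = 0 := clamp_of_nonpos (by simp)
  have ho : clamp (3 * ((1 : I) : ℝ) - 1) = 1 := clamp_of_one_le (by norm_num)
  have hz' : clamp (2 * ((0 : I) : ℝ)) = 0 := clamp_of_nonpos (by simp)
  have ho' : clamp (2 * ((1 : I) : ℝ)) = 1 := clamp_of_one_le (by norm_num)
  refine ⟨⟨⟨⟨fun p => ψ (Function.update p.2.1 j (lerp p.1 (p.2.1 j) (clamp (3 * p.2.1 j - 1))),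
    lerp p.1 p.2.2 (clamp (2 * p.2.2))), by fun_prop⟩, fun p => ?_, fun p => ?_⟩,
    fun t => ⟨fun s u hu => ?_, fun i hi s u => ?_, fun i hi s u hs => ?_⟩⟩⟩
  · simp
  · simp [hφ, faceRetraction_eq hj h]
  · refine h.1 _ _ ?_
    rcases hu with rfl | rfl
    · left; simp only [hz', lerp_self]
    · right; simp only [ho', lerp_self]
  · have hij : j ≠ i := fun e => hj (e ▸ hi)
    simp only [ContinuousMap.coe_mk, Function.update_of_ne hij,
      Function.update_comm hij.symm]
    exact h.2.1 i hi _ _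
  · refine h.2.2 i hi _ _ ?_
    by_cases hij : i = j
    · subst hij
      rcases hs with hs | hs
      · left; simp only [Function.update_self, hs, hz, lerp_self]
      · right; simp only [Function.update_self, hs, ho, lerp_self]
    · simpa only [Function.update_of_ne hij] using hs

/-- Applying `faceRetraction` to every stage of the homotopy makes it trivial on the faces in
direction `j`. Its two ends were trivial there already, so they change only by a homotopy of the
required kind. -/
theorem homotopicWith_of_insert {J : Finset (Fin m)} {j : Fin m} (hj : j ∉ J)
    {ψ₀ ψ₁ : C((Fin m → I) × I, X)} (h₀ : IsPartlyPeriodic x J ψ₀) (h₁ : IsPartlyPeriodic x J ψ₁)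
    (h : ContinuousMap.HomotopicWith ψ₀ ψ₁ fun χ => IsPartlyPeriodic x (insert j J) χ) :
    ContinuousMap.HomotopicWith ψ₀ ψ₁ fun χ => IsPartlyPeriodic x J χ := by
  obtain ⟨F⟩ := h
  have hF : ∀ t, IsPartlyPeriodic x (insert j J) fun p => F (t, p) := F.prop'
  let L : C(I × ((Fin m → I) × I), X) :=
    ⟨fun p => faceRetraction j (fun q => F (p.1, q)) p.2,
      continuous_faceRetraction j F.toContinuousMap hF⟩
  let φ₀ : C((Fin m → I) × I, X) := ⟨fun p => L (0, p), by fun_prop⟩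
  let φ₁ : C((Fin m → I) × I, X) := ⟨fun p => L (1, p), by fun_prop⟩
  have e₀ : ContinuousMap.HomotopicWith ψ₀ φ₀ fun χ => IsPartlyPeriodic x J χ :=
    homotopicWith_faceRetraction hj ψ₀ φ₀ h₀ fun p => by simp [φ₀, L]
  have e₁ : ContinuousMap.HomotopicWith ψ₁ φ₁ fun χ => IsPartlyPeriodic x J χ :=
    homotopicWith_faceRetraction hj ψ₁ φ₁ h₁ fun p => by simp [φ₁, L]
  have e : ContinuousMap.HomotopicWith φ₀ φ₁ fun χ => IsPartlyPeriodic x J χ :=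
    ⟨⟨⟨L, fun p => rfl, fun p => rfl⟩, fun t => (hF t).faceRetraction hj⟩⟩
  exact (e₀.trans e).trans e₁.symm

theorem homotopicWith_empty (J : Finset (Fin m))
    {ψ₀ ψ₁ : C((Fin m → I) × I, X)} (h₀ : IsPartlyPeriodic x ∅ ψ₀) (h₁ : IsPartlyPeriodic x ∅ ψ₁)
    (h : ContinuousMap.HomotopicWith ψ₀ ψ₁ fun χ => IsPartlyPeriodic x J χ) :
    ContinuousMap.HomotopicWith ψ₀ ψ₁ fun χ => IsPartlyPeriodic x ∅ χ := by
  have key : ∀ (J : Finset (Fin m)) (ψ : C((Fin m → I) × I, X)), IsPartlyPeriodic x ∅ ψ →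
      IsPartlyPeriodic x J ψ := fun J ψ hψ => by
    induction J using Finset.induction_on with
    | empty => exact hψ
    | insert j J _ ih => exact ih.insert j
  induction J using Finset.induction_on with
  | empty => exact h
  | insert j J hj ih => exact ih (homotopicWith_of_insert hj (key J _ h₀) (key J _ h₁) h)

/-- A map `S^{m+1} → X` is null homotopic if the composite of its adjoint with the quotient map
from the torus to `S^m` is. -/
theorem eq_one_of_adjointClass_eq_one (f : Ω^ (Fin (m + 1)) X x) (hf : adjointClass f = 1)
    {γ : π_ (m + 1) X x} (hγ : ⟦f⟧ = γ) : γ = 1 := by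
  obtain ⟨K, hK0, hK1, hK⟩ := periodicHomotopic_iff.1 ((TorusClass.mk_eq_iff _ _).1 hf)
  have hsn : Continuous fun p : (Fin m → I) × I =>
      (Fin.snoc (α := fun _ => I) p.1 p.2 : Fin (m + 1) → I) :=
    continuous_snoc continuous_fst continuous_snd
  let ψ₀ : C((Fin m → I) × I, X) := ⟨fun p => f (Fin.snoc (α := fun _ => I) p.1 p.2),
    f.1.continuous.comp hsn⟩
  let ψ₁ : C((Fin m → I) × I, X) := ContinuousMap.const _ x
  have h₀ : IsPartlyPeriodic x ∅ ψ₀ :=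
    ⟨fun s u hu => f.2 _ ⟨Fin.last m, by simpa using hu⟩, by simp,
      fun i _ s u hs => f.2 _ ⟨i.castSucc, by simpa using hs⟩⟩
  have h₁ : IsPartlyPeriodic x ∅ ψ₁ := ⟨fun _ _ _ => rfl, by simp, fun _ _ _ _ _ => rfl⟩
  -- The case `J = univ` describes families of loops on the torus and `J = ∅` describes maps from
  -- the sphere. The given null homotopy lives in the former and is moved to the latter one
  -- coordinate at a time.
  have h : ContinuousMap.HomotopicWith ψ₀ ψ₁ fun χ => IsPartlyPeriodic x Finset.univ χ := by
    refine ⟨⟨⟨⟨fun p => K (p.1, p.2.1) p.2.2, ?_⟩, fun p => ?_, fun p => ?_⟩,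
      fun t => ⟨fun s u hu => ?_, fun i _ s u => ?_, by simp⟩⟩⟩
    · exact (Path.continuous_uncurry_iff.2 K.continuous).comp
        (by fun_prop : Continuous fun p : I × ((Fin m → I) × I) => ((p.1, p.2.1), p.2.2))
    · exact congrArg (fun p : Path x x => p _) (hK0 p.1)
    · exact congrArg (fun p : Path x x => p _) (hK1 p.1)
    · rcases hu with rfl | rfl
      · exact (K (t, s)).source
      · exact (K (t, s)).target
    · exact congrArg (fun p : Path x x => p u) (hK t i s)
  obtain ⟨F⟩ := homotopicWith_empty Finset.univ h₀ h₁ h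
  have hin : Continuous fun v : Fin (m + 1) → I => (Fin.init v : Fin m → I) :=
    continuous_pi fun i => continuous_apply i.castSucc
  rw [HomotopyGroup.one_def, ← hγ]
  refine Quotient.sound ⟨⟨⟨⟨fun p => F (p.1, (Fin.init p.2, p.2 (Fin.last m))), ?_⟩,
      fun v => ?_, fun v => ?_⟩, ?_⟩⟩
  · fun_prop
  · refine (F.apply_zero _).trans ?_
    exact congrArg f (Fin.snoc_init_self v)
  · exact F.apply_one _
  · rintro t v ⟨i, hi⟩
    refine Eq.trans ?_ (f.2 v ⟨i, hi⟩).symm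
    have hF : IsPartlyPeriodic x ∅ fun p => F (t, p) := F.prop' t
    induction i using Fin.lastCases with
    | last => exact hF.1 _ _ hi
    | cast i => exact hF.2.2 i (by simp) _ _ hi

end

end

end NilHtpy

open scoped commutatorElement

namespace NilHtpy

noncomputable section

/-! ### Products of pointed spaces -/

namespace PtdSpace

/-- The product of a family of pointed spaces. -/
def pi {J : Type} (X : J → PtdSpace.{u}) : PtdSpace.{u} :=
  ⟨∀ j, (X j).carrier, fun j => (X j).pt⟩

/-- The projections of a product of pointed spaces. -/
def piProj {J : Type} (X : J → PtdSpace.{u}) (j : J) : pi X ⟶ X j :=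
  Hom.mk ⟨fun x => x j, continuous_apply j⟩ rfl

/-- The map to a product of pointed spaces with given components. -/
def piLift {J : Type} (X : J → PtdSpace.{u}) {Y : PtdSpace.{u}} (f : ∀ j, Y ⟶ X j) : Y ⟶ pi X :=
  Hom.mk ⟨fun y j => (f j).map y, continuous_pi fun j => (f j).map.continuous⟩
    (funext fun j => (f j).map_pt)

theorem hom_ext' {X Y : PtdSpace.{u}} {f g : X ⟶ Y} (h : ∀ x, f.map x = g.map x) : f = g :=
  Hom.ext (ContinuousMap.ext h)

theorem comp_map {X Y Z : PtdSpace.{u}} (f : X ⟶ Y) (g : Y ⟶ Z) :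
    (f ≫ g).map = g.map.comp f.map := rfl

/-- The product of a family of pointed spaces is a product in the category of pointed spaces. -/
def piIsLimit {J : Type} (X : J → PtdSpace.{u}) : IsLimit (Fan.mk (pi X) (piProj X)) :=
  Fan.IsLimit.mk _ (fun s => piLift X s.proj) (fun _ _ => hom_ext' fun _ => rfl)
    fun s _ hf => hom_ext' fun y => funext fun j =>
      congrArg (fun g : s.pt ⟶ X j => g.map y) (hf j)

instance : HasProducts.{0} PtdSpace.{u} :=
  hasProducts_of_limit_fans (fun X => Fan.mk (pi X) (piProj X)) piIsLimit

instance : HasFiniteProducts PtdSpace.{u} :=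
  hasFiniteProducts_of_hasProducts _

/-- The binary product of pointed spaces is a product in the category of pointed spaces. -/
def prodIsLimit (X Y : PtdSpace.{u}) : IsLimit (BinaryFan.mk (fst X Y) (snd X Y)) :=
  BinaryFan.isLimitMk
    (fun s => Hom.mk ⟨fun z => (s.fst.map z, s.snd.map z), by fun_prop⟩
      (Prod.ext s.fst.map_pt s.snd.map_pt))
    (fun s => hom_ext' fun y => rfl) (fun s => hom_ext' fun y => rfl)
    fun s f h h' => hom_ext' fun y => Prod.ext
      (congrArg (fun g : s.pt ⟶ X => g.map y) h) (congrArg (fun g : s.pt ⟶ Y => g.map y) h')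

end PtdSpace

/-! ### Weak equivalences of pointed spaces -/

theorem homotopyGroupMap_comp {X Y Z : Type u} [TopologicalSpace X] [TopologicalSpace Y]
    [TopologicalSpace Z] (n : ℕ) (f : C(X, Y)) (g : C(Y, Z)) (x : X) :
    homotopyGroupMap n (g.comp f) x = homotopyGroupMap n g (f x) ∘ homotopyGroupMap n f x :=
  funext fun a => Quotient.inductionOn a fun _ => rfl

theorem isWeakEquiv_of_inverse {X Y : Type u} [TopologicalSpace X] [TopologicalSpace Y]
    (f : C(X, Y)) (g : C(Y, X)) (hgf : ∀ x, g (f x) = x) (hfg : ∀ y, f (g y) = y) :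
    IsWeakEquiv f := by
  have e : ∀ {A : Type} [TopologicalSpace A] (p : C(A, X)), g.comp (f.comp p) = p := fun p =>
    ContinuousMap.ext fun a => hgf _
  refine fun n x => ⟨homotopyGroupMap_injective_iff.2 fun p q h => ?_,
    homotopyGroupMap_surjective_iff.2 fun q => ?_⟩
  · have := h.comp_continuousMap g
    rwa [e, e] at this
  · refine ⟨⟨g.comp q.1, fun s hs => ?_⟩, ?_⟩
    · rw [ContinuousMap.comp_apply, q.2 s hs, hgf]
    · rw [show f.comp (g.comp q.1) = q.1 from ContinuousMap.ext fun a => hfg _]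
      exact ContinuousMap.HomotopicRel.refl _

theorem weakEquivalences_of_isIso {X Y : PtdSpace.{u}} (f : X ⟶ Y) [IsIso f] :
    weakEquivalences f :=
  isWeakEquiv_of_inverse f.map (inv f).map
    (fun x => congrArg (fun g : X ⟶ X => g.map x) (IsIso.hom_inv_id f))
    (fun y => congrArg (fun g : Y ⟶ Y => g.map y) (IsIso.inv_hom_id f))

instance : weakEquivalences.{u}.IsStableUnderComposition where
  comp_mem f g hf hg n x := by
    rw [PtdSpace.comp_map, homotopyGroupMap_comp]
    exact (hg n _).comp (hf n x)

instance : weakEquivalences.{u}.ContainsIdentities where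
  id_mem X := weakEquivalences_of_isIso (𝟙 X)

instance : weakEquivalences.{u}.RespectsIso :=
  MorphismProperty.respectsIso_of_isStableUnderComposition fun _ _ f (_ : IsIso f) =>
    weakEquivalences_of_isIso f

/-- Maps into a product and their relative homotopies are families of such, so lifts and homotopies
are chosen in each factor separately. -/
theorem isWeakEquiv_pi {J : Type} {X Y : J → Type u} [∀ j, TopologicalSpace (X j)]
    [∀ j, TopologicalSpace (Y j)] (f : ∀ j, C(X j, Y j)) (hf : ∀ j, IsWeakEquiv (f j))
    (F : C(∀ j, X j, ∀ j, Y j)) (hF : ∀ x j, F x j = f j (x j)) : IsWeakEquiv F := by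
  intro n x
  have hx : ∀ j, F x j = f j (x j) := hF x
  refine ⟨homotopyGroupMap_injective_iff.2 fun p q ⟨H⟩ => ?_,
    homotopyGroupMap_surjective_iff.2 fun q => ?_⟩
  · have h : ∀ j, ∃ K : C(I × (Fin n → I), X j), (∀ s, K (0, s) = p s j) ∧
        (∀ s, K (1, s) = q s j) ∧ ∀ t, ∀ s ∈ Cube.boundary (Fin n), K (t, s) = p s j := fun j => by
      let p' : Ω^ (Fin n) (X j) (x j) :=
        ⟨⟨fun s => p s j, by fun_prop⟩, fun s hs => congrFun (p.2 s hs) j⟩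
      let q' : Ω^ (Fin n) (X j) (x j) :=
        ⟨⟨fun s => q s j, by fun_prop⟩, fun s hs => congrFun (q.2 s hs) j⟩
      have e : ((f j).comp p'.1).HomotopicRel ((f j).comp q'.1) (Cube.boundary (Fin n)) :=
        ⟨⟨⟨⟨fun v => H v j, by fun_prop⟩,
          fun s => (congrFun (H.apply_zero s) j).trans (hF (p s) j),
          fun s => (congrFun (H.apply_one s) j).trans (hF (q s) j)⟩,
          fun t s hs => (congrFun (H.eq_fst t hs) j).trans (hF (p s) j)⟩⟩
      obtain ⟨K⟩ := homotopyGroupMap_injective_iff.1 (hf j n (x j)).1 p' q' e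
      exact ⟨K.toContinuousMap, K.apply_zero, K.apply_one, fun t s hs => K.eq_fst t hs⟩
    choose K h0 h1 hK using h
    exact ⟨⟨⟨⟨fun v j => K j v, by fun_prop⟩, fun s => funext fun j => h0 j s,
      fun s => funext fun j => h1 j s⟩, fun t s hs => funext fun j => hK j t s hs⟩⟩
  · have h : ∀ j, ∃ p : Ω^ (Fin n) (X j) (x j), ∃ K : C(I × (Fin n → I), Y j),
        (∀ s, K (0, s) = f j (p s)) ∧ (∀ s, K (1, s) = q s j) ∧
          ∀ t, ∀ s ∈ Cube.boundary (Fin n), K (t, s) = f j (p s) := fun j => by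
      obtain ⟨p, ⟨K⟩⟩ := homotopyGroupMap_surjective_iff.1 (hf j n (x j)).2
        ⟨⟨fun s => q s j, by fun_prop⟩, fun s hs => (congrFun (q.2 s hs) j).trans (hx j)⟩
      exact ⟨p, K.toContinuousMap, K.apply_zero, K.apply_one, fun t s hs => K.eq_fst t hs⟩
    choose p K h0 h1 hK using h
    refine ⟨⟨⟨fun s j => p j s, continuous_pi fun j => (p j).1.continuous⟩,
      fun s hs => funext fun j => (p j).2 s hs⟩,
      ⟨⟨⟨⟨fun v j => K j v, by fun_prop⟩, fun s => funext fun j => ?_,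
      fun s => funext fun j => h1 j s⟩, fun t s hs => funext fun j => ?_⟩⟩⟩
    · exact (h0 j s).trans (hF (fun j => p j s) j).symm
    · exact (hK j t s hs).trans (hF (fun j => p j s) j).symm

theorem weakEquivalences_piMap {J : Type} (X Y : J → PtdSpace.{u}) (f : ∀ j, X j ⟶ Y j)
    (hf : ∀ j, weakEquivalences (f j)) : weakEquivalences (Limits.Pi.map f) := by
  let g : PtdSpace.pi X ⟶ PtdSpace.pi Y := PtdSpace.piLift Y fun j => PtdSpace.piProj X j ≫ f j
  have hg : weakEquivalences g := isWeakEquiv_pi (fun j => (f j).map) hf g.map fun x j => rfl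
  refine (weakEquivalences.arrow_mk_iso_iff (Arrow.isoMk
    ((productIsProduct X).conePointUniqueUpToIso (PtdSpace.piIsLimit X))
    ((productIsProduct Y).conePointUniqueUpToIso (PtdSpace.piIsLimit Y)) ?_)).2 hg
  refine (PtdSpace.piIsLimit Y).hom_ext fun ⟨j⟩ => ?_
  have h₁ := (productIsProduct X).conePointUniqueUpToIso_hom_comp (PtdSpace.piIsLimit X) ⟨j⟩
  have h₂ := (productIsProduct Y).conePointUniqueUpToIso_hom_comp (PtdSpace.piIsLimit Y) ⟨j⟩
  have h₃ : g ≫ (Fan.mk (PtdSpace.pi Y) (PtdSpace.piProj Y)).π.app ⟨j⟩ =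
    (Fan.mk (PtdSpace.pi X) (PtdSpace.piProj X)).π.app ⟨j⟩ ≫ f j := rfl
  simp only [Arrow.mk_hom, Category.assoc]
  rw [h₂, h₃, reassoc_of% h₁]
  simp

/-- This makes the localization functor `toHo` preserve finite products, so `ΩX × ΩX` is a product
in the homotopy category as well. -/
instance : weakEquivalences.{u}.IsStableUnderFiniteProducts where
  isStableUnderProductsOfShape _ _ :=
    MorphismProperty.IsStableUnderProductsOfShape.mk _ _ fun X Y _ _ f hf =>
      weakEquivalences_piMap X Y f hf

/-! ### Homotopy classes of maps from a torus, as a functor on the homotopy category -/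

/-- The functor that sends a pointed space to the set of free homotopy classes of maps from the
`m`-dimensional torus. -/
def torusFunctor (m : ℕ) : PtdSpace.{u} ⥤ Type u where
  obj Y := TorusClass m Y.carrier
  map f := TypeCat.ofHom (TorusClass.map m f.map)
  map_id Y := by
    ext a
    induction a using TorusClass.ind
    rfl
  map_comp f g := by
    ext a
    induction a using TorusClass.ind
    rfl

theorem torusFunctor_inverts (m : ℕ) : weakEquivalences.{u}.IsInvertedBy (torusFunctor m) := by
  intro Y Z f hf
  have : Nonempty Y.carrier := ⟨Y.pt⟩
  exact (isIso_iff_bijective _).2 (IsWeakEquiv.bijective_torusClassMap (f := f.map) hf m)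

/-- The extension of `torusFunctor` to the homotopy category. -/
def hoTorusFunctor (m : ℕ) : HoSpaces.{u} ⥤ Type u :=
  Localization.Construction.lift (torusFunctor m) (torusFunctor_inverts m)

theorem hoTorusFunctor_map_toHo (m : ℕ) {Y Z : PtdSpace.{u}} (f : Y ⟶ Z)
    (a : TorusClass m Y.carrier) :
    (hoTorusFunctor m).map (toHo.map f) a = TorusClass.map m f.map a := by
  have := Functor.congr_hom (Localization.Construction.fac (torusFunctor m)
    (torusFunctor_inverts m)) f
  simp only [Functor.comp_map] at this
  exact congrArg (fun g : (torusFunctor m).obj Y ⟶ (torusFunctor m).obj Z => g a) this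

end

end NilHtpy

open scoped commutatorElement

namespace NilHtpy

noncomputable section

/-! ### Iterated commutators and the lower central series -/

/-- This is `[Γ_i, Γ_j] ≤ Γ_{i+j}`; indexing from `0` produces the extra `1`. The induction on `j`
uses the three subgroups lemma, applied in the quotient by the target term, where the containments
become vanishing statements. -/
theorem commutator_lowerCentralSeries_le (G : Type*) [Group G] (i j : ℕ) :
    ⁅(⊤ : Subgroup G).lowerCentralSeries i, (⊤ : Subgroup G).lowerCentralSeries j⁆ ≤
      (⊤ : Subgroup G).lowerCentralSeries (i + j + 1) := by
  induction j generalizing i with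
  | zero => exact le_rfl
  | succ j ih =>
    let N := (⊤ : Subgroup G).lowerCentralSeries (i + (j + 1) + 1)
    have hN : ∀ H : Subgroup G, H.map (QuotientGroup.mk' N) = ⊥ ↔ H ≤ N := fun H => by
      rw [Subgroup.map_eq_bot_iff, QuotientGroup.ker_mk']
    change _ ≤ N
    rw [← hN, Subgroup.map_commutator, Subgroup.commutator_comm,
      Subgroup.lowerCentralSeries_succ, Subgroup.map_commutator]
    refine Subgroup.commutator_commutator_eq_bot_of_rotate ?_ ?_
    · rw [← Subgroup.map_commutator, ← Subgroup.map_commutator, hN,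
        Subgroup.commutator_comm ⊤, ← Subgroup.lowerCentralSeries_succ]
      exact (ih (i + 1)).trans (le_of_eq (congrArg _ (by omega)))
    · rw [← Subgroup.map_commutator, ← Subgroup.map_commutator, hN]
      exact Subgroup.commutator_mono (ih i) le_rfl

/-- An iterated commutator is the value of a word in the corresponding term of the lower central
series of a free group. -/
theorem IsIteratedCommutator.exists_word {G : Type*} [Group G] {k : ℕ} {g : G}
    (h : IsIteratedCommutator k g) :
    ∃ (j r : ℕ) (w : FreeGroup (Fin (r + 1))) (t : Fin (r + 1) → G), k = j + 1 ∧
      w ∈ (⊤ : Subgroup (FreeGroup (Fin (r + 1)))).lowerCentralSeries j ∧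
      FreeGroup.lift t w = g := by
  induction h with
  | single g => exact ⟨0, 0, FreeGroup.of 0, fun _ => g, rfl, trivial, by simp⟩
  | bracket _ _ ih ih' =>
    obtain ⟨j, r, w, t, rfl, hw, rfl⟩ := ih
    obtain ⟨j', r', w', t', rfl, hw', rfl⟩ := ih'
    -- The two words are placed on disjoint sets of variables, so that one tuple `T` evaluates both.
    let φ : FreeGroup (Fin (r + 1)) →* FreeGroup (Fin (r + 1 + (r' + 1))) :=
      FreeGroup.map (Fin.castAdd (r' + 1))
    let φ' : FreeGroup (Fin (r' + 1)) →* FreeGroup (Fin (r + 1 + (r' + 1))) :=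
      FreeGroup.map (Fin.natAdd (r + 1))
    let T : Fin (r + 1 + (r' + 1)) → G := Fin.append t t'
    have e : (FreeGroup.lift T).comp φ = FreeGroup.lift t := by
      ext i
      simp [φ, T]
    have e' : (FreeGroup.lift T).comp φ' = FreeGroup.lift t' := by
      ext i
      simp [φ', T]
    have hφ : ∀ {A B : Type} [Group A] [Group B] (f : A →* B) (i : ℕ),
        ∀ a ∈ (⊤ : Subgroup A).lowerCentralSeries i, f a ∈ (⊤ : Subgroup B).lowerCentralSeries i :=
      fun f i a ha => by
        have := Subgroup.mem_map_of_mem f ha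
        rw [Subgroup.map_lowerCentralSeries] at this
        exact Subgroup.lowerCentralSeries_mono i le_top this
    refine ⟨j + j' + 1, r + 1 + r', ⁅φ w, φ' w'⁆, T, by omega, ?_, ?_⟩
    · exact commutator_lowerCentralSeries_le _ j j'
        (Subgroup.commutator_mem_commutator (hφ φ j w hw) (hφ φ' j' w' hw'))
    · rw [map_commutatorElement, ← e, ← e']
      rfl

/-! ### The theory of nilpotent groups -/

namespace NilTheory

/-- The morphism of `Nil_n` given by the substitution of words for the generators. -/
def subst (n : ℕ) {j k : ℕ} (w : Fin (j + 1) → FreeGroup (Fin (k + 1))) :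
    NilTheory.obj n j ⟶ NilTheory.obj n k :=
  QuotientGroup.map ((⊤ : Subgroup (FreeGroup (Fin (j + 1)))).lowerCentralSeries n)
    ((⊤ : Subgroup (FreeGroup (Fin (k + 1)))).lowerCentralSeries n)
    (FreeGroup.lift w) (by
      rw [← Subgroup.map_le_iff_le_comap, Subgroup.map_lowerCentralSeries]
      exact Subgroup.lowerCentralSeries_mono n le_top)

theorem hom_ext {n k : ℕ} {T : NilTheory n} {f g : NilTheory.obj n k ⟶ T}
    (h : ∀ i : Fin (k + 1), f.toFun (QuotientGroup.mk (FreeGroup.of i)) =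
      g.toFun (QuotientGroup.mk (FreeGroup.of i))) : f = g :=
  QuotientGroup.monoidHom_ext _ (FreeGroup.ext_hom _ _ h)

theorem ofWord_comp_subst {n j k : ℕ} (v : FreeGroup (Fin (j + 1)))
    (w : Fin (j + 1) → FreeGroup (Fin (k + 1))) :
    ofWord n j v ≫ subst n w = ofWord n k (FreeGroup.lift w v) := by
  refine hom_ext fun i => ?_
  change (QuotientGroup.mk (FreeGroup.lift w (FreeGroup.lift (fun _ => v) (FreeGroup.of i))) :
    FreeNil n (k + 1)) = QuotientGroup.mk (FreeGroup.lift (fun _ => FreeGroup.lift w v)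
      (FreeGroup.of i))
  simp

/-- Here the class bound enters: words in `Γ_{n+1}` give the trivial operation. -/
theorem ofWord_eq_of_mem {n k : ℕ} {w : FreeGroup (Fin (k + 1))}
    (hw : w ∈ (⊤ : Subgroup (FreeGroup (Fin (k + 1)))).lowerCentralSeries n) :
    ofWord n k w = ofWord n k 1 := by
  refine hom_ext fun i => ?_
  change (QuotientGroup.mk (FreeGroup.lift (fun _ => w) (FreeGroup.of i)) :
    FreeNil n (k + 1)) = QuotientGroup.mk (FreeGroup.lift (fun _ => 1) (FreeGroup.of i))
  simpa using (QuotientGroup.eq_one_iff w).2 hw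

theorem lowerCentralSeries_freeNil (n k : ℕ) :
    (⊤ : Subgroup (FreeNil n k)).lowerCentralSeries n = ⊥ := by
  have h := Subgroup.map_lowerCentralSeries (⊤ : Subgroup (FreeGroup (Fin k)))
    (QuotientGroup.mk' ((⊤ : Subgroup (FreeGroup (Fin k))).lowerCentralSeries n)) n
  rw [Subgroup.map_top_of_surjective _ (QuotientGroup.mk'_surjective _)] at h
  rw [← h, Subgroup.map_eq_bot_iff, QuotientGroup.ker_mk']

/-- The generator of the free nilpotent group of rank one. -/
def gen (n : ℕ) : FreeNil n (obj n 0).rank :=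
  QuotientGroup.mk (FreeGroup.of (0 : Fin 1))

theorem hom_ext_gen {n : ℕ} {T : NilTheory n} {f g : NilTheory.obj n 0 ⟶ T}
    (h : f.toFun (gen n) = g.toFun (gen n)) : f = g :=
  hom_ext fun i => by
    have : i = (0 : Fin 1) := Fin.fin_one_eq_zero i
    subst this
    exact h

/-- The universal property of the free nilpotent group. -/
def desc {n k : ℕ} {T : NilTheory n} (t : Fin (k + 1) → FreeNil n T.rank) :
    NilTheory.obj n k ⟶ T :=
  QuotientGroup.lift ((⊤ : Subgroup (FreeGroup (Fin (k + 1)))).lowerCentralSeries n)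
    (FreeGroup.lift t) fun w hw => by
      have h := Subgroup.mem_map_of_mem (FreeGroup.lift t) hw
      rw [Subgroup.map_lowerCentralSeries] at h
      have h' : FreeGroup.lift t w ∈ (⊤ : Subgroup (FreeNil n T.rank)).lowerCentralSeries n :=
        Subgroup.lowerCentralSeries_mono n le_top h
      rwa [lowerCentralSeries_freeNil, Subgroup.mem_bot] at h'

theorem ofWord_comp_desc {n k : ℕ} {T : NilTheory n} (f : Fin (k + 1) → (obj n 0 ⟶ T))
    (i : Fin (k + 1)) :
    ofWord n k (FreeGroup.of i) ≫
      desc (fun i => (f i).toFun (gen n)) = f i := by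
  refine hom_ext_gen ?_
  change FreeGroup.lift (fun i => (f i).toFun (gen n))
    (FreeGroup.lift (fun _ : Fin 1 => FreeGroup.of i) (FreeGroup.of 0)) = _
  simp

/-- In `Nil_nᵒᵖ`, the object `k` is the `k`-fold power of the object `1`. -/
def isLimitFan (n k : ℕ) : IsLimit (Fan.mk (op (NilTheory.obj n k))
    fun i : Fin (k + 1) => (ofWord n k (FreeGroup.of i)).op) :=
  Fan.IsLimit.mk _
    (fun s => (desc (T := s.pt.unop) fun i =>
      (s.proj i).unop.toFun (gen n)).op)
    (fun s i => Quiver.Hom.unop_inj (ofWord_comp_desc (fun i => (s.proj i).unop) i))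
    fun s m hm => Quiver.Hom.unop_inj (hom_ext fun i => by
      have h := congrArg (fun g => g.unop.toFun (gen n)) (hm i)
      change m.unop.toFun (QuotientGroup.mk (FreeGroup.lift (fun _ : Fin 1 => FreeGroup.of i)
        (FreeGroup.of 0))) = _ at h
      rw [FreeGroup.lift_apply_of] at h
      refine h.trans ?_
      exact (FreeGroup.lift_apply_of (β := FreeNil n s.pt.unop.rank)).symm)

end NilTheory

/-! ### The group of homotopy classes is nilpotent -/

section

variable {X : PtdSpace.{u}} {n : ℕ} (N : NilGroupUpToHomotopy.{u} n)
  (φ : N.functor.obj (op (NilTheory.obj n 0)) ≅ toHo.obj X.loop)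

/-- The operation `N(k) → ΩX` given by a word. -/
def wordOp (k : ℕ) (w : FreeGroup (Fin (k + 1))) :
    N.functor.obj (op (NilTheory.obj n k)) ⟶ toHo.obj X.loop :=
  N.functor.map (NilTheory.ofWord n k w).op ≫ φ.hom

theorem map_subst_wordOp {j k : ℕ} (v : FreeGroup (Fin (j + 1)))
    (w : Fin (j + 1) → FreeGroup (Fin (k + 1))) :
    N.functor.map (NilTheory.subst n w).op ≫ wordOp N φ j v =
      wordOp N φ k (FreeGroup.lift w v) := by
  rw [wordOp, wordOp, ← Functor.map_comp_assoc, ← op_comp, NilTheory.ofWord_comp_subst]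

/-- `N(k)` is the `k`-fold power of `N(1)` in the homotopy category. -/
def NilGroupUpToHomotopy.isLimitFan (k : ℕ) : IsLimit (Fan.mk
    (N.functor.obj (op (NilTheory.obj n k)))
    fun i : Fin (k + 1) => N.functor.map (NilTheory.ofWord n k (FreeGroup.of i)).op) :=
  have := N.preserves k
  isLimitFanMkObjOfIsLimit N.functor _ _ (NilTheory.isLimitFan n k)

theorem wordOp_hom_ext {k : ℕ} {A : HoSpaces.{u}}
    {f g : A ⟶ N.functor.obj (op (NilTheory.obj n k))}
    (h : ∀ i, f ≫ wordOp N φ k (FreeGroup.of i) = g ≫ wordOp N φ k (FreeGroup.of i)) : f = g := by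
  refine Fan.IsLimit.hom_ext (N.isLimitFan k) _ _ fun i => ?_
  have := h i
  simp only [wordOp, ← Category.assoc] at this
  exact (cancel_mono φ.hom).1 this

theorem exists_wordOp_lift {k : ℕ} {A : HoSpaces.{u}} (f : Fin (k + 1) → (A ⟶ toHo.obj X.loop)) :
    ∃ g : A ⟶ N.functor.obj (op (NilTheory.obj n k)),
      ∀ i, g ≫ wordOp N φ k (FreeGroup.of i) = f i := by
  refine ⟨Fan.IsLimit.lift (N.isLimitFan k) fun i => f i ≫ φ.inv, fun i => ?_⟩
  have h := Fan.IsLimit.fac (N.isLimitFan k) (fun i => f i ≫ φ.inv) i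
  rw [wordOp, ← Category.assoc]
  erw [h]
  simp

/-- The operation `[T^m, N(k)] → [T^m, ΩX]` given by a word. -/
def torusWordOp (m k : ℕ) (w : FreeGroup (Fin (k + 1)))
    (ξ : (hoTorusFunctor m).obj (N.functor.obj (op (NilTheory.obj n k)))) :
    TorusClass m (LoopSpace X.carrier X.pt) :=
  (hoTorusFunctor m).map (wordOp N φ k w) ξ

/-- Every family of elements of `[T^m, ΩX]` comes from an element of `[T^m, N(k)]`. -/
theorem exists_torusClass (m k : ℕ) (t : Fin (k + 1) → TorusClass m (LoopSpace X.carrier X.pt)) :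
    ∃ ξ : (hoTorusFunctor m).obj (N.functor.obj (op (NilTheory.obj n k))),
      ∀ i, torusWordOp N φ m k (FreeGroup.of i) ξ = t i := by
  -- The projections of the actual product `(ΩX)^{k+1}` assemble to a morphism `g` into `N(k+1)`, as
  -- `obj n k` has rank `k + 1`. Representatives of the `t i` together define a torus class in that
  -- product, and its image under `g` is the required element.
  obtain ⟨g, hg⟩ := exists_wordOp_lift N φ
    fun i : Fin (k + 1) => toHo.map (PtdSpace.piProj (fun _ => X.loop) i)
  have h : ∀ i, ∃ (χ : C(Fin m → I, X.loop.carrier)) (h : IsPeriodic χ), TorusClass.mk χ h = t i :=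
    fun i => TorusClass.ind (p := fun a => ∃ (χ : C(Fin m → I, X.loop.carrier))
      (h : IsPeriodic χ), TorusClass.mk χ h = a) (fun χ h => ⟨χ, h, rfl⟩) (t i)
  choose χ hχ ht using h
  let a : TorusClass m (PtdSpace.pi fun _ : Fin (k + 1) => X.loop).carrier :=
    TorusClass.mk ⟨fun s i => χ i s, continuous_pi fun i => (χ i).continuous⟩
      fun j s => funext fun i => hχ i j s
  refine ⟨(hoTorusFunctor m).map g a, fun i => ?_⟩
  rw [← ht i]
  have := hoTorusFunctor_map_toHo m (PtdSpace.piProj (fun _ : Fin (k + 1) => X.loop) i) a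
  rw [← hg i, Functor.map_comp] at this
  exact this

variable (e : toHo.obj (X.loop.prod X.loop) ⟶ N.functor.obj (op (NilTheory.obj n 1)))
  (h₀ : e ≫ wordOp N φ 1 (FreeGroup.of 0) = toHo.map (PtdSpace.fst X.loop X.loop))
  (h₁ : e ≫ wordOp N φ 1 (FreeGroup.of 1) = toHo.map (PtdSpace.snd X.loop X.loop))
  (hc : e ≫ wordOp N φ 1 (FreeGroup.of 0 * FreeGroup.of 1) = toHo.map (PtdSpace.concat X))

include h₀ h₁ in
/-- The comparison map from `ΩX × ΩX` to `N(2)` is a split epimorphism. -/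
theorem exists_section : ∃ d : N.functor.obj (op (NilTheory.obj n 1)) ⟶
    toHo.obj (X.loop.prod X.loop), d ≫ e = 𝟙 _ := by
  have hl := mapIsLimitOfPreservesOfIsLimit toHo _ _ (PtdSpace.prodIsLimit X.loop X.loop)
  obtain ⟨d, hd₀, hd₁⟩ := BinaryFan.IsLimit.lift' hl (wordOp N φ 1 (FreeGroup.of 0))
    (wordOp N φ 1 (FreeGroup.of 1))
  refine ⟨d, wordOp_hom_ext N φ fun i => ?_⟩
  rw [Category.assoc, Category.id_comp]
  fin_cases i
  · exact (congrArg (d ≫ ·) h₀).trans hd₀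
  · exact (congrArg (d ≫ ·) h₁).trans hd₁

include h₀ h₁ hc in
-- Since `e` has a section, every `η` comes from a torus class in `ΩX × ΩX`. There the three words
-- act as the projections and concatenation, and concatenation defines the product of torus classes.
theorem torusWordOp_mul (m : ℕ) (η : (hoTorusFunctor m).obj (N.functor.obj (op (NilTheory.obj n 1)))) :
    torusWordOp N φ m 1 (FreeGroup.of 0 * FreeGroup.of 1) η =
      torusWordOp N φ m 1 (FreeGroup.of 0) η * torusWordOp N φ m 1 (FreeGroup.of 1) η := by
  obtain ⟨d, hd⟩ := exists_section N φ e h₀ h₁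
  obtain ⟨ζ, rfl⟩ : ∃ ζ : TorusClass m (X.loop.prod X.loop).carrier,
      (hoTorusFunctor m).map e ζ = η := by
    refine ⟨(hoTorusFunctor m).map d η, ?_⟩
    have := congrArg (fun g => (hoTorusFunctor m).map g η) hd
    simpa using this
  have key : ∀ w (f : X.loop.prod X.loop ⟶ X.loop), e ≫ wordOp N φ 1 w = toHo.map f →
      torusWordOp N φ m 1 w ((hoTorusFunctor m).map e ζ) =
        TorusClass.map m f.map ζ := fun w f hf => by
    have h := hoTorusFunctor_map_toHo m f ζ
    rw [← hf, Functor.map_comp] at h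
    exact h
  rw [key _ _ h₀, key _ _ h₁, key _ _ hc]
  induction ζ using TorusClass.ind
  rfl

include h₀ h₁ hc in
-- The commutator is the value at `t` of a word in `Γ_{n+1}` of a free group. Evaluation at `t` is
-- the action of words on a single `ξ`, and that action depends only on the class of the word in the
-- free nilpotent group.
theorem eq_one_of_isIteratedCommutator (m : ℕ) {g : TorusClass m (LoopSpace X.carrier X.pt)}
    (hg : IsIteratedCommutator (n + 1) g) : g = 1 := by
  obtain ⟨j, r, w, t, hj, hw, rfl⟩ := hg.exists_word
  obtain rfl : n = j := by omega
  obtain ⟨ξ, hξ⟩ := exists_torusClass N φ m r t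
  let Φ : FreeGroup (Fin (r + 1)) →* TorusClass m (LoopSpace X.carrier X.pt) :=
    -- Multiplicativity reduces to the word `x₁x₂` by substituting `v` and `w` for its two
    -- variables, which moves `ξ` to a class in `N(2)`.
    MonoidHom.mk' (fun w => torusWordOp N φ m r w ξ) fun v w => by
      have h : ∀ v', torusWordOp N φ m 1 v'
          ((hoTorusFunctor m).map (N.functor.map (NilTheory.subst n ![v, w]).op) ξ) =
          torusWordOp N φ m r (FreeGroup.lift ![v, w] v') ξ := fun v' => by
        rw [torusWordOp, torusWordOp, ← map_subst_wordOp, Functor.map_comp]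
        rfl
      have := torusWordOp_mul N φ e h₀ h₁ hc m
        ((hoTorusFunctor m).map (N.functor.map (NilTheory.subst n ![v, w]).op) ξ)
      rw [h, h, h] at this
      simpa using this
  have hΦ : Φ = FreeGroup.lift t := FreeGroup.ext_hom _ _ fun i => by
    rw [FreeGroup.lift_apply_of]
    exact hξ i
  rw [← hΦ]
  have : Φ w = Φ 1 := by
    change torusWordOp N φ m r w ξ = torusWordOp N φ m r 1 ξ
    rw [torusWordOp, torusWordOp, wordOp, wordOp, NilTheory.ofWord_eq_of_mem hw]
  rw [this, map_one]

end

end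

end NilHtpy

theorem proposition4p4 (X : NilHtpy.PtdSpace.{u}) (n : ℕ)
    (hX : NilHtpy.LoopSpaceIsNilpotentUpToHomotopy X n) :
    ∀ (m : ℕ) (γ : π_ (m + 1) X.carrier X.pt),
      NilHtpy.IsIteratedWhiteheadProduct (n + 1) m γ → γ = 1 := by
  intro m γ hγ
  obtain ⟨N, φ, e, h₀, h₁, hc⟩ := hX
  obtain ⟨f, hf⟩ := Quotient.exists_rep γ
  exact NilHtpy.eq_one_of_adjointClass_eq_one f
    (NilHtpy.eq_one_of_isIteratedCommutator N φ e h₀ h₁ hc m (hγ.isIteratedCommutator f hf)) hf
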